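/- Let $d\ge 3$, let $K$ be a number field of degree $k=[K:\mathbb Q]$ with ring of integers $\mathfrak o$, let $\mathcal P_K$ be the set of nonzero primes $\mathfrak p$ of $\mathfrak o$, $N\mathfrak p=|\mathfrak o/\mathfrak p|$, $\mathfrak o_{\mathfrak p}$ the completed local ring with normalized Haar measure $\nu_{\mathfrak p}$ (on $\mathfrak o_{\mathfrak p}^m$), and $k_\infty=\mathfrak o\otimes_{\mathbb Z}\mathbb R$. For an integral basis $\mathbb E=(e_1,\dots,e_k)$ of $\mathfrak o$ put $O(H,\mathbb E)=\{\sum a_je_j: a_j\in\mathbb Z\cap[-H,H)\}$; the (upper) density of $T\subseteq\mathfrak o^{m}$ with respect to $\mathbb E$ is the limit (superior) of $|T\cap O(H,\mathbb E)^m|/(2H)^{km}$ as $H\to\infty$. Identify $a=(a_0,\dots,a_d)$ with $f=\sum a_ix^i$ and let $\sigma_b f(x)=f(x+b)$. Call $f\in\mathfrak o^{d+1}$ $\mathfrak p$-Eisenstein if $a_d\notin\mathfrak p$, $a_0\notin\mathfrak p^2$ and $a_i\in\mathfrak p$ for $i<d$. Let $\widetilde\Gamma^d\subseteq \mathfrak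 o^{d+1}$ be the set of shifted Eisenstein polynomials, i.e. of all $f$ such that $f(x+b)$ is $\mathfrak p$-Eisenstein for some $\mathfrak p\in\mathcal P_K$ and $b\in\mathfrak o$. Put $U_{\mathfrak p}=(\mathfrak p\mathfrak o_{\mathfrak p}\setminus\mathfrak p^2\mathfrak o_{\mathfrak p})\times(\mathfrak p\mathfrak o_{\mathfrak p})^{d-1}\times(\mathfrak o_{\mathfrak p}\setminus\mathfrak p\mathfrak o_{\mathfrak p})$, $\widetilde U_{\mathfrak p}=\bigcup_{b+\mathfrak p\in\mathfrak o/\mathfrak p}\sigma_b^{-1}(U_{\mathfrak p})$ and $\widetilde U_\infty=\emptyset\subseteq k_\infty^{d+1}$. For $a\in\mathfrak o^{d+1}$ let $X(a)$ be the number of $\eta\in\mathcal P_K\cup\{\infty\}$ with $a\in\widetilde U_\eta$, let $I=\{a: X(a)=\infty\}$, and let $B_H=O(H,\mathbb E)^{d+1}\setminus I$. **(a)** $\sigma_b^{-1}(U_{\mathfrak p})$ depends only on $b+\mathfrak p$, and the union defining $\widetilde U_{\mathfrak p}$ is disjoint. **(b)** For every $\mathbb E$, the system $(\widetilde U_\eta)$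 corresponds to $\widetilde\Gamma^d$: the tail condition below holds, and $a\notin\widetilde\Gamma^d$ if and only if $a$ lies in no $\widetilde U_\eta$. **(c)** For every $\mathbb E$ and every $n\ge1$ the system satisfies the hypotheses of the local-to-global principle for the $n$-th moment, namely: - $\nu_{\mathfrak p}(\partial\widetilde U_{\mathfrak p})=0$ for all $\mathfrak p$, $\partial\widetilde U_\infty$ has Lebesgue measure $0$, and $\mathbb R_{\ge0}\cdot\widetilde U_\infty=\widetilde U_\infty$; - (tail condition) the upper density of the set of $a\in\mathfrak o^{d+1}$ that lie in $\widetilde U_{\mathfrak p}$ for some $\mathfrak p$ above a rational prime $p>M$ tends to $0$ as $M\to\infty$; - there are a real $\alpha\ge0$ and integers $c',c$ such that for all integers $H\ge1$ and all $a\in B_H$, fewer than $c$ primes $\mathfrak p$ above a rational prime $p>c'H^\alpha$ satisfy $a\in\widetilde U_{\mathfrak p}$; and there is a family of real numbers $(v_{\mathfrak p})_{\mathfrak p\in\mathcal P_K}$, independent of $H$, with $\sum_{\mathfrak p}v_{\mathfrak p}$ convergent, such that for all integers $H\ge1$, all $1\le r\le n$ and all pairwise distinct $\mathfrak p_1,\dots,\mathfrak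 p_r$ above rational primes $\le c'H^\alpha$, $$\Big|B_H\cap\bigcap_{j=1}^r\widetilde U_{\mathfrak p_j}\Big|\le(2H)^{k(d+1)}\prod_{j=1}^r v_{\mathfrak p_j}.$$ **(d)** Put $s_{\mathfrak p}=\dfrac{(N\mathfrak p-1)^2}{N\mathfrak p^{\,d+1}}$. The series $\sum s_{\mathfrak p}$, $\sum s_{\mathfrak p}^2$ and the product $\prod(1-s_{\mathfrak p})$ over $\mathcal P_K$ converge. With $$\rho=1-\prod_{\mathfrak p\in\mathcal P_K}(1-s_{\mathfrak p})>0,\qquad \mu=\sum_{\mathfrak p\in\mathcal P_K}s_{\mathfrak p},\qquad \mu_{\widetilde\Gamma^d}=\rho^{-1}\mu,$$ for every integral basis $\mathbb E$ the following limits exist and have the stated values: the density of $\widetilde\Gamma^d$ is $\rho$; the mean number of primes is $\lim_H (2H)^{-k(d+1)}\sum_{a\in B_H}X(a)=\mu$; the restricted mean is $\lim_H |B_H\cap\widetilde\Gamma^d|^{-1}\sum_{a\in B_H\cap\widetilde\Gamma^d}X(a)=\mu_{\widetilde\Gamma^d}$; and the restricted variance is $$\lim_{H\to\infty}\frac{\sum_{a\in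 B_H\cap\widetilde\Gamma^d}\big(X(a)-\mu_{\widetilde\Gamma^d}\big)^2}{|O(H,\mathbb E)^{d+1}\cap\widetilde\Gamma^d|}=\frac1\rho\Big(\mu^2-\sum_{\mathfrak p\in\mathcal P_K}s_{\mathfrak p}^2+\mu\Big)-\frac{2\mu_{\widetilde\Gamma^d}}{\rho}\,\mu+\mu_{\widetilde\Gamma^d}^2 .$$ -/

import Mathlib

open NumberField IsDedekindDomain Polynomial Filter Topology
open scoped WithZero Pointwise Classical

noncomputable section

namespace LocalToGlobal

/-! ### Local integers and their Haar measure -/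

/-- The ring of integers is dense in its completion at `v`, to first order. -/
theorem exists_algebraMap_sub_lt_one (K : Type*) [Field K] [NumberField K]
    (v : HeightOneSpectrum (𝓞 K)) (x : v.adicCompletionIntegers K) :
    ∃ a : 𝓞 K, Valued.v (((algebraMap (𝓞 K) (v.adicCompletionIntegers K) a - x :
      v.adicCompletionIntegers K) : v.adicCompletion K)) < (1 : ℤᵐ⁰) := by
  have ho : IsOpen {y : v.adicCompletion K | Valued.v (y - x) < (1 : ℤᵐ⁰)} := by
    have h1 : IsOpen {y : v.adicCompletion K | Valued.v y < (1 : ℤᵐ⁰)} := by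
      have := Valued.isOpen_ball (v.adicCompletion K) (Γ₀ := ℤᵐ⁰) 1
      simpa [Valuation.restrict_lt_one_iff] using this
    exact h1.preimage (continuous_id.sub continuous_const)
  obtain ⟨k, hk⟩ := (HeightOneSpectrum.denseRange_algebraMap K v).exists_mem_open ho
    ⟨(x : v.adicCompletion K), by simp⟩
  have hk1 : v.valuation K k ≤ 1 := by
    rw [← HeightOneSpectrum.valuedAdicCompletion_eq_valuation']
    have : ((k : K) : v.adicCompletion K) = (algebraMap K (v.adicCompletion K) k - x) + x := by
      rw [sub_add_cancel]; rfl
    rw [this]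
    exact (Valued.v.map_add _ _).trans (max_le hk.le x.2)
  obtain ⟨a, ha⟩ := v.exists_valuation_sub_lt_of_integer (K := K) hk1 1
  refine ⟨a, ?_⟩
  have e : (((algebraMap (𝓞 K) (v.adicCompletionIntegers K) a - x :
      v.adicCompletionIntegers K) : v.adicCompletion K)) =
      algebraMap K (v.adicCompletion K) (algebraMap (𝓞 K) K a - k) +
        (algebraMap K (v.adicCompletion K) k - x) := by
    rw [map_sub]; simp; rfl
  rw [e]
  refine (Valued.v.map_add _ _).trans_lt (max_lt ?_ hk)
  have := HeightOneSpectrum.valuedAdicCompletion_eq_valuation' v (algebraMap (𝓞 K) K a - k)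
  rw [← this] at ha
  exact ha

/-- The ring of integers of the completion of a number field at a finite place is compact. -/
instance compactSpace_adicCompletionIntegers (K : Type*) [Field K] [NumberField K]
    (v : HeightOneSpectrum (𝓞 K)) : CompactSpace (v.adicCompletionIntegers K) := by
  have : CompactSpace (Valued.integer (v.adicCompletion K)) := by
    rw [Valued.integer.compactSpace_iff_completeSpace_and_isDiscreteValuationRing_and_finite_residueField]
    refine ⟨?_, ?_, ?_⟩
    · exact (Valued.isClosed_integer (v.adicCompletion K)).completeSpace_coe
    · exact inferInstanceAs (IsDiscreteValuationRing (v.adicCompletionIntegers K))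
    · have hfin : Finite (𝓞 K ⧸ v.asIdeal) := Ideal.finiteQuotientOfFreeOfNeBot _ v.ne_bot
      let g : 𝓞 K → Valued.integer (v.adicCompletion K) := fun r =>
        ⟨(algebraMap (𝓞 K) (v.adicCompletionIntegers K) r : v.adicCompletionIntegers K),
          (algebraMap (𝓞 K) (v.adicCompletionIntegers K) r).2⟩
      refine Finite.of_surjective (fun q : 𝓞 K ⧸ v.asIdeal =>
        IsLocalRing.residue (Valued.integer (v.adicCompletion K)) (g q.out)) ?_
      intro y
      obtain ⟨x, rfl⟩ := IsLocalRing.residue_surjective y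
      let x' : v.adicCompletionIntegers K := ⟨x, x.2⟩
      obtain ⟨a, ha⟩ := exists_algebraMap_sub_lt_one K v x'
      refine ⟨Ideal.Quotient.mk _ a, ?_⟩
      have hm : (Ideal.Quotient.mk v.asIdeal a).out - a ∈ v.asIdeal := by
        rw [← Ideal.Quotient.eq, Ideal.Quotient.mk_out]
      set a' := (Ideal.Quotient.mk v.asIdeal a).out
      have h1 : Valued.v (((algebraMap (𝓞 K) (v.adicCompletionIntegers K) (a' - a) :
          v.adicCompletionIntegers K) : v.adicCompletion K)) < (1 : ℤᵐ⁰) := by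
        rw [HeightOneSpectrum.algebraMap_adicCompletionIntegers_apply,
          HeightOneSpectrum.valuedAdicCompletion_eq_valuation']
        exact (v.valuation_lt_one_iff_mem _).2 hm
      change IsLocalRing.residue _ (g a') = _
      rw [← sub_eq_zero, ← map_sub, IsLocalRing.residue_eq_zero_iff,
        IsLocalRing.mem_maximalIdeal, mem_nonunits_iff,
        Valuation.Integer.not_isUnit_iff_valuation_lt_one]
      have e : (algebraMap (𝓞 K) (v.adicCompletionIntegers K) a' - x' :
          v.adicCompletionIntegers K) = algebraMap (𝓞 K) (v.adicCompletionIntegers K) (a' - a) +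
            (algebraMap (𝓞 K) (v.adicCompletionIntegers K) a - x') := by
        rw [map_sub]; ring
      change Valued.v (((algebraMap (𝓞 K) (v.adicCompletionIntegers K) a' - x' :
          v.adicCompletionIntegers K) : v.adicCompletion K)) < (1 : ℤᵐ⁰)
      rw [e]
      exact (Valued.v.map_add _ _).trans_lt (max_lt h1 ha)
  exact this

/-- The normalized Haar measure on `𝔬_𝔭 ^ m`, with respect to the Borel `σ`-algebra. -/
def haar (K : Type*) [Field K] [NumberField K] (m : ℕ) (v : HeightOneSpectrum (𝓞 K)) :
    @MeasureTheory.Measure (Fin m → v.adicCompletionIntegers K) (borel _) :=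
  letI : MeasurableSpace (Fin m → v.adicCompletionIntegers K) := borel _
  haveI : BorelSpace (Fin m → v.adicCompletionIntegers K) := ⟨rfl⟩
  MeasureTheory.Measure.addHaarMeasure ⊤

/-- The rational prime `p` lying below `𝔭`, i.e. the positive generator of `𝔭 ∩ ℤ`. -/
def below {K : Type*} [Field K] [NumberField K] (v : HeightOneSpectrum (𝓞 K)) : ℕ :=
  Ideal.absNorm (v.asIdeal.under ℤ)

/-! ### Boxes and densities with respect to an integral basis -/

/-- Integral bases of `𝔬`. -/
abbrev IntegralBasis (K : Type*) [Field K] [NumberField K] : Type _ :=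
  Module.Basis (Fin (Module.finrank ℚ K)) ℤ (𝓞 K)

section Density

variable {K : Type*} [Field K] [NumberField K]

/-- `O(H, 𝔼) = { ∑ a_j e_j : a_j ∈ [-H, H) ∩ ℤ }`. -/
def intBox (E : IntegralBasis K) (H : ℕ) : Finset (𝓞 K) :=
  (Fintype.piFinset fun _ : Fin (Module.finrank ℚ K) => Finset.Ico (-(H : ℤ)) (H : ℤ)).image
    fun c => ∑ j, c j • E j

/-- `O(H, 𝔼)^m`. -/
def box (E : IntegralBasis K) (m H : ℕ) : Finset (Fin m → 𝓞 K) :=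
  Fintype.piFinset fun _ => intBox E H

/-- `(2H)^{km}` with `k = [K : ℚ]`, the number of points of `O(H, 𝔼)^m`. -/
def boxSize (K : Type*) [Field K] [NumberField K] (m H : ℕ) : ℝ :=
  (2 * (H : ℝ)) ^ (Module.finrank ℚ K * m)

/-- The proportion of `O(H, 𝔼)^m` lying in `T`. -/
def boxRatio (E : IntegralBasis K) {m : ℕ} (T : Set (Fin m → 𝓞 K)) (H : ℕ) : ℝ :=
  ((box E m H).filter (· ∈ T)).card / boxSize K m H

/-- The upper density of `T` with respect to `𝔼`. -/
def upperDensity (E : IntegralBasis K) {m : ℕ} (T : Set (Fin m → 𝓞 K)) : ℝ :=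
  limsup (boxRatio E T) atTop

/-- The density of `T` with respect to `𝔼` exists and equals `δ`. -/
def HasDensity (E : IntegralBasis K) {m : ℕ} (T : Set (Fin m → 𝓞 K)) (δ : ℝ) : Prop :=
  Tendsto (boxRatio E T) atTop (𝓝 δ)

end Density

/-! ### Systems of local sets, their hypotheses and moments -/

/-- A family `(U_η)`, `η` a nonzero prime of `𝔬` or `η = ∞`, with `U_𝔭 ⊆ 𝔬_𝔭 ^ m` and
`U_∞ ⊆ k_∞ ^ m`, where `k_∞ = 𝔬 ⊗ ℝ` is realised as `ℝ ^ r₁ × ℂ ^ r₂`. -/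
structure LocalSystem (K : Type*) [Field K] [NumberField K] (m : ℕ) where
  /-- the set `U_𝔭` -/
  finite : ∀ v : HeightOneSpectrum (𝓞 K), Set (Fin m → v.adicCompletionIntegers K)
  /-- the set `U_∞` -/
  infinite : Set (Fin m → mixedEmbedding.mixedSpace K)

namespace LocalSystem

variable {K : Type*} [Field K] [NumberField K] {m : ℕ} (U : LocalSystem K m)

/-- `a ∈ U_𝔭`, for a vector `a` over `𝔬`. -/
def MemFinite (v : HeightOneSpectrum (𝓞 K)) (a : Fin m → 𝓞 K) : Prop :=
  (fun i => algebraMap (𝓞 K) (v.adicCompletionIntegers K) (a i)) ∈ U.finite v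

/-- `a ∈ U_∞`, for a vector `a` over `𝔬`. -/
def MemInfinite (a : Fin m → 𝓞 K) : Prop :=
  (fun i => mixedEmbedding K (a i : K)) ∈ U.infinite

/-- The map `P`: the set of all `η` with `a ∈ U_η`; `none` stands for `∞`. -/
def places (a : Fin m → 𝓞 K) : Set (Option (HeightOneSpectrum (𝓞 K))) :=
  {η | η.elim (U.MemInfinite a) (fun v => U.MemFinite v a)}

/-- The set `I` of vectors that lie in infinitely many `U_η`. -/
def exceptional : Set (Fin m → 𝓞 K) := {a | (U.places a).Infinite}

/-- `O(H, 𝔼)_I^m`: the box without the exceptional set. -/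
def boxI (E : IntegralBasis K) (H : ℕ) : Finset (Fin m → 𝓞 K) :=
  (box E m H).filter (· ∉ U.exceptional)

/-- The tail condition: the upper density of the vectors lying in `U_𝔭` for some `𝔭` above a
rational prime `p > M` tends to `0` as `M → ∞`. -/
def TailCondition (E : IntegralBasis K) : Prop :=
  Tendsto (fun M : ℕ => upperDensity E {a | ∃ v, M < below v ∧ U.MemFinite v a}) atTop (𝓝 0)

/-- The system corresponds to `T ⊆ 𝔬 ^ m`: the tail condition holds and the complement of `T`
consists of the vectors that lie in no `U_η`. -/
def CorrespondsTo (E : IntegralBasis K) (T : Set (Fin m → 𝓞 K)) : Prop :=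
  U.TailCondition E ∧ Tᶜ = {a | U.places a = ∅}

/-- The hypotheses of the local-to-global principle for the `n`-th moment. In the last one `S` runs
over the sets `{𝔭_1, …, 𝔭_r}` of `1 ≤ r ≤ n` pairwise distinct primes. The exponent `α` is asked to
be finite, which is more than allowing `α ∈ [0, ∞]`; the weights `w` do not depend on `H`. -/
structure MomentConditions (E : IntegralBasis K) (n : ℕ) : Prop where
  frontier_finite : ∀ v, haar K m v (frontier (U.finite v)) = 0
  frontier_infinite : MeasureTheory.volume (frontier U.infinite) = 0
  cone : Set.Ici (0 : ℝ) • U.infinite = U.infinite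
  tail : U.TailCondition E
  bounds : ∃ (α : ℝ) (c' c : ℤ), 0 ≤ α ∧
    (∀ H : ℕ, 1 ≤ H → ∀ a ∈ U.boxI E H,
      {v | (c' : ℝ) * (H : ℝ) ^ α < below v ∧ U.MemFinite v a}.Finite ∧
      ({v | (c' : ℝ) * (H : ℝ) ^ α < below v ∧ U.MemFinite v a}.ncard : ℤ) < c) ∧
    ∃ w : HeightOneSpectrum (𝓞 K) → ℝ, Summable w ∧
      ∀ H : ℕ, 1 ≤ H → ∀ S : Finset (HeightOneSpectrum (𝓞 K)), S.Nonempty → S.card ≤ n →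
        (∀ v ∈ S, (below v : ℝ) ≤ (c' : ℝ) * (H : ℝ) ^ α) →
        (((U.boxI E H).filter fun a => ∀ v ∈ S, U.MemFinite v a).card : ℝ) ≤
          boxSize K m H * ∏ v ∈ S, w v

/-- The `n`-th moment of the system exists and equals `l`. -/
def HasMoment (E : IntegralBasis K) (n : ℕ) (l : ℝ) : Prop :=
  Tendsto (fun H : ℕ => (∑ a ∈ U.boxI E H, ((U.places a).ncard : ℝ) ^ n) / boxSize K m H)
    atTop (𝓝 l)

/-- The `n`-th moment of the system restricted to `T` exists and equals `l`. -/
def HasRestrictedMoment (E : IntegralBasis K) (T : Set (Fin m → 𝓞 K)) (n : ℕ) (l : ℝ) : Prop :=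
  Tendsto (fun H : ℕ => (∑ a ∈ (U.boxI E H).filter (· ∈ T), ((U.places a).ncard : ℝ) ^ n) /
    ((U.boxI E H).filter (· ∈ T)).card) atTop (𝓝 l)

/-- The variance of the system restricted to `T` (the mean square deviation from the restricted
mean) exists and equals `l`. -/
def HasRestrictedVariance (E : IntegralBasis K) (T : Set (Fin m → 𝓞 K)) (l : ℝ) : Prop :=
  ∃ μT : ℝ, U.HasRestrictedMoment E T 1 μT ∧
    Tendsto (fun H : ℕ => (∑ a ∈ (U.boxI E H).filter (· ∈ T),
      (((U.places a).ncard : ℝ) - μT) ^ 2) / ((box E m H).filter (· ∈ T)).card) atTop (𝓝 l)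

end LocalSystem

/-! ### Shifted Eisenstein polynomials -/

section Eisenstein

/-- The polynomial `a_0 + a_1 x + ⋯ + a_d x ^ d`. -/
def toPoly {R : Type*} [CommRing R] {d : ℕ} (a : Fin (d + 1) → R) : R[X] :=
  ∑ i, C (a i) * X ^ (i : ℕ)

/-- The map `σ_b : f(x) ↦ f(x + b)` on coefficient vectors. -/
def shift {R : Type*} [CommRing R] {d : ℕ} (b : R) (a : Fin (d + 1) → R) : Fin (d + 1) → R :=
  fun i => ((toPoly a).comp (X + C b)).coeff i

/-- The set `(P ∖ P²) × P ^ (d - 1) × (R ∖ P)` (for `d ≥ 1`). -/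
def eisensteinSet {R : Type*} [CommRing R] (P : Ideal R) (d : ℕ) : Set (Fin (d + 1) → R) :=
  {a | a 0 ∉ P ^ 2 ∧ (∀ i, i ≠ Fin.last d → a i ∈ P) ∧ a (Fin.last d) ∉ P}

variable (K : Type*) [Field K] [NumberField K] (d : ℕ)

/-- The set of shifted Eisenstein polynomials of degree `d` over `𝔬`. -/
def shiftedEisenstein : Set (Fin (d + 1) → 𝓞 K) :=
  {a | ∃ (v : HeightOneSpectrum (𝓞 K)) (b : 𝓞 K), shift b a ∈ eisensteinSet v.asIdeal d}

/-- The set `σ_b⁻¹(U_𝔭) ⊆ 𝔬_𝔭 ^ (d + 1)`, where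
`U_𝔭 = (𝔭𝔬_𝔭 ∖ 𝔭²𝔬_𝔭) × (𝔭𝔬_𝔭) ^ (d - 1) × (𝔬_𝔭 ∖ 𝔭𝔬_𝔭)`. -/
def localPiece (v : HeightOneSpectrum (𝓞 K)) (b : 𝓞 K) :
    Set (Fin (d + 1) → v.adicCompletionIntegers K) :=
  shift (algebraMap (𝓞 K) (v.adicCompletionIntegers K) b) ⁻¹'
    eisensteinSet (v.asIdeal.map (algebraMap (𝓞 K) (v.adicCompletionIntegers K))) d

/-- The system with `U_𝔭` the union of `localPiece K d 𝔭 b` over representatives `b` of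
`𝔬 ⧸ 𝔭`, and `U_∞ = ∅`. -/
def shiftedEisensteinSystem : LocalSystem K (d + 1) where
  finite v := ⋃ β : 𝓞 K ⧸ v.asIdeal, localPiece K d v β.out
  infinite := ∅

end Eisenstein

end LocalToGlobal

end

/-! Write `N` for the norm of 𝔭. If some translate of `f` is Eisenstein at 𝔭, then `f ≡ a_d (x -
b)^d` modulo 𝔭. Every coefficient of `d^d a_d^(d-1) f - (d a_d x + a_(d-1))^d`, the `powerDefect` of
`a`, therefore lies in 𝔭. These defects do not all vanish: otherwise evaluating at `b` and comparing
𝔭-adic valuations gives `d ∣ 1` (`exists_powerDefect_ne_zero`). Hence a vector lies in only finitely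
many local sets and `I` is empty. Moreover a defect is a form of degree `d` in the coefficients, so
its norm is `O(H^(dk))` on the box, and only boundedly many 𝔭 above `p > H^β` can contain it.

Large primes are negligible (`tendsto_boxRatio_memFinite_large`). The defect at `d - 2` does not
involve `a_(d-3)`, while the defect at `d - 3` is affine in it with slope `d^d a_d^(d-1)`, which is
a unit modulo 𝔭 once `p > d`. If the first defect is nonzero, it leaves boundedly many 𝔭, and each
confines `a_(d-3)` to one class modulo 𝔭. If it is zero, `a_(d-2)` is determined by the other
coefficients. This is where `d ≥ 3` matters; it also makes the local densities `O(N^(-2))`, hence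
summable.

Small primes are governed by congruences. Membership at 𝔭 depends only on `a` modulo 𝔭², and a count
there gives the proportion `s_𝔭` (`card_residueSet_div`). The Chinese remainder theorem makes
distinct primes independent, with exact limits for a fixed finite set of primes and, up to a
constant factor, uniform upper bounds for at most `n` primes above `p ≤ H^(1/(2n))`
(`boxRatio_forall_memFinite_le`).

Together these give the tail condition and the moment hypotheses. The density follows by sieving
with finitely many primes. The moments follow by dominated convergence over primes and pairs of
primes, the large primes contributing an error that Cauchy–Schwarz controls. The local sets are
clopen, so their boundaries are empty. -/

namespace LocalToGlobal

/-! ### Translation of polynomials, the Eisenstein condition and the power defect -/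

section Shift

variable {R : Type*} [CommRing R] {d : ℕ}

theorem coeff_toPoly (a : Fin (d + 1) → R) (i : Fin (d + 1)) :
    (toPoly a).coeff i = a i := by
  simp [toPoly, coeff_X_pow, ← Fin.ext_iff]

theorem natDegree_toPoly_le (a : Fin (d + 1) → R) : (toPoly a).natDegree ≤ d := by
  refine natDegree_sum_le_of_forall_le _ _ fun i _ => ?_
  exact (natDegree_C_mul_X_pow_le _ _).trans (Nat.lt_succ_iff.1 i.2)

theorem toPoly_coeff {p : R[X]} (hp : p.natDegree ≤ d) :
    toPoly (fun i : Fin (d + 1) => p.coeff i) = p := by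
  ext n
  rcases lt_or_ge n (d + 1) with h | h
  · exact coeff_toPoly _ ⟨n, h⟩
  · rw [coeff_eq_zero_of_natDegree_lt ((natDegree_toPoly_le _).trans_lt h),
      coeff_eq_zero_of_natDegree_lt (hp.trans_lt h)]

theorem toPoly_shift (b : R) (a : Fin (d + 1) → R) :
    toPoly (shift b a) = (toPoly a).comp (X + C b) := by
  refine toPoly_coeff (natDegree_comp_le.trans ?_)
  calc _ ≤ d * 1 := Nat.mul_le_mul (natDegree_toPoly_le a) (by compute_degree)
    _ = d := mul_one d

theorem shift_shift (b c : R) (a : Fin (d + 1) → R) : shift b (shift c a) = shift (b + c) a := by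
  funext i
  rw [shift, toPoly_shift, shift, comp_assoc]
  simp [add_assoc]

theorem shift_zero (a : Fin (d + 1) → R) : shift 0 a = a := by
  funext i
  simp [shift, coeff_toPoly]

theorem shift_bijective (b : R) : Function.Bijective (shift (d := d) b) :=
  Function.bijective_iff_has_inverse.2 ⟨shift (-b), fun a => by simp [shift_shift, shift_zero],
    fun a => by simp [shift_shift, shift_zero]⟩

theorem shift_map {S : Type*} [CommRing S] (φ : R →+* S) (b : R) (a : Fin (d + 1) → R) :
    shift (φ b) (fun i => φ (a i)) = fun i => φ (shift b a i) := by
  have h : toPoly (fun i => φ (a i)) = (toPoly a).map φ := by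
    simp [toPoly, Polynomial.map_sum]
  funext i
  rw [shift, h, shift, ← coeff_map, Polynomial.map_comp]
  simp

theorem shift_apply (b : R) (a : Fin (d + 1) → R) (j : Fin (d + 1)) :
    shift b a j = ∑ i : Fin (d + 1), a i * (b ^ ((i : ℕ) - j) * ((i : ℕ).choose j : R)) := by
  rw [shift, toPoly, ← coe_compRingHom_apply, map_sum]
  simp [coeff_X_add_C_pow]

theorem shift_last (b : R) (a : Fin (d + 1) → R) : shift b a (Fin.last d) = a (Fin.last d) := by
  rw [shift_apply, Finset.sum_eq_single (Fin.last d)]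
  · simp
  · intro i _ hi
    have : (i : ℕ) < d := Fin.val_lt_last hi
    simp [Nat.choose_eq_zero_of_lt this]
  · simp

theorem shift_apply_zero (b : R) (a : Fin (d + 1) → R) :
    shift b a 0 = ∑ i : Fin (d + 1), a i * b ^ (i : ℕ) := by
  simp [shift_apply]

variable {P : Ideal R}

/-- Modulo `P` only the leading term survives, so the translate is `a_d (x + c)^d`. -/
theorem shift_sub_mem {a : Fin (d + 1) → R} (ha : ∀ i, i ≠ Fin.last d → a i ∈ P) (c : R)
    (j : Fin (d + 1)) :
    shift c a j - a (Fin.last d) * (c ^ (d - (j : ℕ)) * (d.choose j : R)) ∈ P := by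
  rw [shift_apply, ← Finset.add_sum_erase _ _ (Finset.mem_univ (Fin.last d))]
  simp only [Fin.val_last, add_sub_cancel_left]
  exact sum_mem fun i hi => P.mul_mem_right _ (ha i (Finset.ne_of_mem_erase hi))

/-- The delicate coefficient is the constant one. It changes by terms `a_i c^i` with `a_i, c ∈ P`,
which lie in `P²`, and by `a_d c^d`, which lies in `P²` because `d ≥ 2`. -/
theorem shift_mem_eisensteinSet (hd : 2 ≤ d) {a : Fin (d + 1) → R} (ha : a ∈ eisensteinSet P d)
    {c : R} (hc : c ∈ P) : shift c a ∈ eisensteinSet P d := by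
  obtain ⟨h0, h1, h2⟩ := ha
  refine ⟨?_, fun j hj => ?_, by rwa [shift_last]⟩
  · have : shift c a 0 - a 0 ∈ P ^ 2 := by
      rw [shift_apply_zero, ← Finset.add_sum_erase _ _ (Finset.mem_univ 0)]
      simp only [Fin.val_zero, pow_zero, mul_one, add_sub_cancel_left]
      refine sum_mem fun i hi => ?_
      have hi0 : (i : ℕ) ≠ 0 := fun h => Finset.ne_of_mem_erase hi (Fin.ext h)
      by_cases hl : i = Fin.last d
      · exact Ideal.mul_mem_left _ _ (Ideal.pow_le_pow_right (by simpa [hl] using hd)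
          (Ideal.pow_mem_pow hc (i : ℕ)))
      · rw [pow_two]
        exact Ideal.mul_mem_mul (h1 i hl) (Ideal.pow_mem_of_mem _ hc _ (Nat.pos_of_ne_zero hi0))
    exact fun h => h0 (by simpa using sub_mem h this)
  · have hj' : (j : ℕ) < d := Fin.val_lt_last hj
    have := shift_sub_mem h1 c j
    have h3 : a (Fin.last d) * (c ^ (d - (j : ℕ)) * (d.choose j : R)) ∈ P :=
      Ideal.mul_mem_left _ _ (Ideal.mul_mem_right _ _ (Ideal.pow_mem_of_mem _ hc _ (by omega)))
    simpa using add_mem this h3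

theorem shift_mem_eisensteinSet_iff (hd : 2 ≤ d) {a : Fin (d + 1) → R} {b b' : R}
    (h : b - b' ∈ P) : shift b a ∈ eisensteinSet P d ↔ shift b' a ∈ eisensteinSet P d := by
  constructor
  · intro H
    have := shift_mem_eisensteinSet hd H (by simpa using neg_mem h : b' - b ∈ P)
    simpa [shift_shift] using this
  · intro H
    simpa [shift_shift] using shift_mem_eisensteinSet hd H h

/-- Both translates reduce to `a_d x^d`. Comparing constant terms puts `a_d (b - b')^d` in `P`, and
`a_d ∉ P`. -/
theorem sub_mem_of_shift_mem (hP : P.IsPrime) {a : Fin (d + 1) → R} (hd : 1 ≤ d) {b b' : R}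
    (h : shift b a ∈ eisensteinSet P d) (h' : shift b' a ∈ eisensteinSet P d) : b - b' ∈ P := by
  have e : shift b a = shift (b - b') (shift b' a) := by simp [shift_shift]
  have h0 : shift (b - b') (shift b' a) 0 ∈ P := e ▸ h.2.1 0 (by simp [Fin.ext_iff]; omega)
  have h1 := shift_sub_mem h'.2.1 (b - b') 0
  have h2 := sub_mem h0 h1
  simp only [Fin.val_zero, tsub_zero, Nat.choose_zero_right, Nat.cast_one, mul_one,
    sub_sub_cancel] at h2
  exact hP.mem_of_pow_mem _ ((hP.mem_or_mem h2).resolve_left h'.2.2)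

theorem map_mem_eisensteinSet_iff {S : Type*} [CommRing S] {Q : Ideal S} (φ : R →+* S)
    (h1 : ∀ x, φ x ∈ Q ↔ x ∈ P) (h2 : ∀ x, φ x ∈ Q ^ 2 ↔ x ∈ P ^ 2) (a : Fin (d + 1) → R) :
    (fun i => φ (a i)) ∈ eisensteinSet Q d ↔ a ∈ eisensteinSet P d := by
  simp [eisensteinSet, h1, h2]

/-- The `j`-th coefficient of `d ^ d a_d ^ (d - 1) f(x) - (d a_d x + a_{d - 1}) ^ d`; these vanish
when `f` is a constant times a `d`-th power of a monic linear polynomial. -/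
def powerDefect (a : Fin (d + 1) → R) (j : Fin (d + 1)) : R :=
  (d : R) ^ d * a (Fin.last d) ^ (d - 1) * a j -
    (d.choose j : R) * (d * a (Fin.last d)) ^ (j : ℕ) * a (Fin.ofNat _ (d - 1)) ^ (d - (j : ℕ))

theorem powerDefect_map {S : Type*} [CommRing S] (φ : R →+* S) (a : Fin (d + 1) → R)
    (j : Fin (d + 1)) : φ (powerDefect a j) = powerDefect (fun i => φ (a i)) j := by
  simp [powerDefect]

/-- Translating back by `-b` gives `a_j ≡ a_d (d choose j) (-b)^(d-j)`. In particular `a_(d-1) ≡ -d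
a_d b`, and after substitution the two terms of the defect agree. -/
theorem powerDefect_mem (hd : 1 ≤ d) {a : Fin (d + 1) → R} {b : R}
    (h : ∀ i, i ≠ Fin.last d → shift b a i ∈ P) (j : Fin (d + 1)) : powerDefect a j ∈ P := by
  have key (j : Fin (d + 1)) : Ideal.Quotient.mk P (a j) = Ideal.Quotient.mk P
      (a (Fin.last d) * ((-b) ^ (d - (j : ℕ)) * (d.choose j : R))) := by
    have := shift_sub_mem h (-b) j
    rwa [shift_shift, neg_add_cancel, shift_zero, shift_last, ← Ideal.Quotient.eq] at this
  rw [← Ideal.Quotient.eq_zero_iff_mem, powerDefect]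
  have hj : (j : ℕ) ≤ d := Nat.lt_succ_iff.1 j.2
  have e1 : ((Fin.ofNat (d + 1) (d - 1) : Fin (d + 1)) : ℕ) = d - 1 := by
    simp [Nat.mod_eq_of_lt (show d - 1 < d + 1 by omega)]
  have e2 : d.choose (d - 1) = d := by
    rw [Nat.choose_symm hd, Nat.choose_one_right]
  simp only [map_sub, map_mul, map_pow, key j, key (Fin.ofNat _ (d - 1)), e1, e2,
    Nat.sub_sub_self hd, pow_one]
  set c := Ideal.Quotient.mk P (a (Fin.last d))
  set D := Ideal.Quotient.mk P (d : R)
  set β := Ideal.Quotient.mk P (-b)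
  obtain ⟨e, he⟩ := Nat.exists_eq_add_of_le hj
  have e3 : d - (j : ℕ) = e := by omega
  have e4 : c ^ (d - 1) * c = c ^ (j : ℕ) * c ^ e := by
    rw [← pow_succ, ← pow_add]; congr 1; omega
  have e5 : D ^ d = D ^ (j : ℕ) * D ^ e := by rw [← pow_add, ← he]
  rw [e3, e5, mul_pow, mul_pow, mul_pow]
  linear_combination (D ^ (j : ℕ) * D ^ e * β ^ e * Ideal.Quotient.mk P (d.choose j : R)) * e4

/-- The binomial theorem, evaluated at `b`. It turns vanishing of all defects into an equation
between `f(b)` and a `d`-th power. -/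
theorem sum_powerDefect (a : Fin (d + 1) → R) (b : R) :
    ∑ j, powerDefect a j * b ^ (j : ℕ) = (d : R) ^ d * a (Fin.last d) ^ (d - 1) * shift b a 0 -
      (d * a (Fin.last d) * b + a (Fin.ofNat _ (d - 1))) ^ d := by
  rw [shift_apply_zero, add_pow, ← Fin.sum_univ_eq_sum_range (fun m => (d * a (Fin.last d) * b) ^ m *
    a (Fin.ofNat _ (d - 1)) ^ (d - m) * (d.choose m : R)), Finset.mul_sum, ← Finset.sum_sub_distrib]
  refine Finset.sum_congr rfl fun j _ => ?_
  rw [powerDefect]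
  ring

end Shift

/-! ### Lattice points of a coordinate box in residue classes -/

section Counting

/-- An interval of length `2H` meets a class modulo `q` in `2H/q` points, up to an error of one;
both bounds are multiplied by `q`. -/
theorem card_Ico_filter_zmod {q : ℕ} (hq : 0 < q) (H : ℕ) (r : ZMod q) :
    (2 * H - q : ℝ) ≤ q * ((Finset.Ico (-(H : ℤ)) H).filter fun t : ℤ => (t : ZMod q) = r).card ∧
    (q * ((Finset.Ico (-(H : ℤ)) H).filter fun t : ℤ => (t : ZMod q) = r).card : ℝ) ≤ 2 * H + q := by
  obtain ⟨v, rfl⟩ := ZMod.intCast_surjective r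
  have hq' : (0 : ℝ) < q := by exact_mod_cast hq
  have e : ((Finset.Ico (-(H : ℤ)) H).filter fun t : ℤ => (t : ZMod q) = v) =
      (Finset.Ico (-(H : ℤ)) H).filter fun t : ℤ => t ≡ v [ZMOD q] := by
    simp only [ZMod.intCast_eq_intCast_iff]
  have h := Int.Ico_filter_modEq_card (-(H : ℤ)) H (r := q) (by exact_mod_cast hq) v
  rw [e]
  set N := ((Finset.Ico (-(H : ℤ)) H).filter fun t : ℤ => t ≡ v [ZMOD q]).card
  set x : ℚ := ((H : ℤ) - v : ℚ) / (q : ℤ)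
  set y : ℚ := ((-(H : ℤ) : ℤ) - v : ℚ) / (q : ℤ)
  have hqQ : (0 : ℚ) < q := by exact_mod_cast hq
  have hxy : q * (x - y) = 2 * H := by
    simp only [x, y]; push_cast; field_simp; ring
  have hN : (N : ℤ) = max (⌈x⌉ - ⌈y⌉) 0 := h
  have hxy0 : y ≤ x := by
    by_contra! hlt
    have : (q : ℚ) * (x - y) < 0 := mul_neg_of_pos_of_neg hqQ (by linarith)
    rw [hxy] at this
    have : (0 : ℚ) ≤ 2 * H := by positivity
    linarith
  rw [max_eq_left (sub_nonneg.2 (Int.ceil_mono hxy0))] at hN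
  have hN' : (N : ℚ) = ⌈x⌉ - ⌈y⌉ := by exact_mod_cast hN
  have h1 := Int.le_ceil x
  have h2 := Int.ceil_lt_add_one x
  have h3 := Int.le_ceil y
  have h4 := Int.ceil_lt_add_one y
  have hlo : (2 * H - q : ℚ) ≤ q * N := by rw [← hxy]; nlinarith
  have hhi : (q * N : ℚ) ≤ 2 * H + q := by rw [← hxy]; nlinarith
  exact ⟨by exact_mod_cast hlo, by exact_mod_cast hhi⟩

theorem card_preimage_of_surjective {B A : Type*} [AddGroup B] [AddGroup A] [Fintype B] [Fintype A]
    (f : B →+ A) (hf : Function.Surjective f) (s : Finset A) :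
    (Finset.univ.filter fun b => f b ∈ s).card * Fintype.card A = s.card * Fintype.card B := by
  set c := (Finset.univ.filter fun b => f b = 0).card
  have hc (y : A) : (Finset.univ.filter fun b => f b = y).card = c :=
    AddMonoidHom.card_fiber_eq_of_mem_range f (hf y) (hf 0)
  have key (s : Finset A) : (Finset.univ.filter fun b => f b ∈ s).card = s.card * c := by
    rw [Finset.card_eq_sum_card_fiberwise (f := f) (t := s) (by intro x; simp), Finset.sum_const_nat]
    intro y hy
    rw [← hc y]
    congr 1
    ext b
    simp only [Finset.mem_filter, Finset.mem_univ, true_and]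
    exact ⟨fun h => h.2, fun h => ⟨h ▸ hy, h⟩⟩
  have huniv : Fintype.card B = Fintype.card A * c := by
    simpa using key Finset.univ
  rw [key, huniv]
  ring

variable {G ι : Type*} [AddCommGroup G] [Fintype ι] (B : Module.Basis ι ℤ G)

/-- The elements all of whose coordinates with respect to `B` lie in `[-H, H)`. -/
noncomputable def coordBox (H : ℕ) : Finset G :=
  (Fintype.piFinset fun _ : ι => Finset.Ico (-(H : ℤ)) (H : ℤ)).map B.equivFun.symm.toEquiv.toEmbedding

theorem mem_coordBox {H : ℕ} {x : G} :
    x ∈ coordBox B H ↔ ∀ i, B.repr x i ∈ Finset.Ico (-(H : ℤ)) (H : ℤ) := by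
  simp only [coordBox, Finset.mem_map_equiv, Fintype.mem_piFinset]
  rfl

theorem card_coordBox (H : ℕ) : (coordBox B H).card = (2 * H) ^ Fintype.card ι := by
  simp [coordBox, Fintype.card_piFinset, ← two_mul]
  congr 1

/-- The coordinates modulo `q`. -/
noncomputable def coordMod (q : ℕ) : G →+ (ι → ZMod q) :=
  AddMonoidHom.mk' (fun x i => (B.repr x i : ZMod q)) (by intro x y; funext i; simp)

theorem card_coordBox_filter_coordMod (q H : ℕ) (r : ι → ZMod q) :
    ((coordBox B H).filter fun x => coordMod B q x = r).card =
      ∏ i, ((Finset.Ico (-(H : ℤ)) H).filter fun t : ℤ => (t : ZMod q) = r i).card := by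
  rw [← Fintype.card_piFinset]
  refine Finset.card_bij (fun x _ => B.equivFun x) ?_ (fun _ _ _ _ h => B.equivFun.injective h) ?_
  · intro x hx
    rw [Finset.mem_filter, mem_coordBox] at hx
    simp only [Fintype.mem_piFinset, Finset.mem_filter]
    exact fun i => ⟨hx.1 i, congrFun hx.2 i⟩
  · intro c hc
    simp only [Fintype.mem_piFinset, Finset.mem_filter] at hc
    refine ⟨B.equivFun.symm c, ?_, B.equivFun.apply_symm_apply c⟩
    have e (i) : B.repr (B.equivFun.symm c) i = c i := congrFun (B.equivFun.apply_symm_apply c) i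
    rw [Finset.mem_filter, mem_coordBox]
    refine ⟨fun i => by rw [e]; exact (hc i).1, ?_⟩
    funext i
    change ((B.repr _ i : ℤ) : ZMod q) = _
    rw [e]
    exact (hc i).2

theorem coordMod_surjective (q : ℕ) : Function.Surjective (coordMod B q) := by
  intro r
  choose c hc using fun i => ZMod.intCast_surjective (r i)
  refine ⟨B.equivFun.symm c, ?_⟩
  funext i
  have e : B.repr (B.equivFun.symm c) i = c i := congrFun (B.equivFun.apply_symm_apply c) i
  change ((B.repr _ i : ℤ) : ZMod q) = _
  rw [e, hc]

theorem exists_eq_nsmul_of_coordMod_eq_zero {q : ℕ} {x : G} (hx : coordMod B q x = 0) :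
    ∃ y, x = q • y := by
  have h (i) : ∃ t : ℤ, B.repr x i = q * t :=
    (ZMod.intCast_zmod_eq_zero_iff_dvd (B.repr x i) q).1 (congrFun hx i)
  choose t ht using h
  refine ⟨B.equivFun.symm t, B.ext_elem fun i => ?_⟩
  have e : B.repr (B.equivFun.symm t) i = t i := congrFun (B.equivFun.apply_symm_apply t) i
  rw [map_nsmul, Finsupp.smul_apply, e, ht, nsmul_eq_mul]

/-- Points of a coordinate box with prescribed image in a finite quotient killed by `q`. -/
theorem card_coordBox_filter {A : Type*} [AddCommGroup A] [Fintype A] (π : G →+ A)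
    (hπ : Function.Surjective π) {q : ℕ} (hq : 0 < q) (hk : ∀ x, π (q • x) = 0) (s : Finset A)
    {T : Set G} (hT : ∀ x, x ∈ T ↔ π x ∈ s) (H : ℕ) :
    (((coordBox B H).filter (· ∈ T)).card : ℝ) ≤
      (s.card / Fintype.card A : ℝ) * (2 * H + q) ^ Fintype.card ι ∧
    (q ≤ 2 * H → (s.card / Fintype.card A : ℝ) * (2 * H - q) ^ Fintype.card ι ≤
      ((coordBox B H).filter (· ∈ T)).card) := by
  have : NeZero q := ⟨hq.ne'⟩
  -- Vectors with coordinates divisible by `q` die in `A`, so `π` factors through the coordinates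
  -- modulo `q`. The count becomes a sum over residue vectors, whose number is found from the equal
  -- fibres of a surjective homomorphism.
  have hker : (coordMod B q).ker ≤ π.ker := by
    intro x hx
    obtain ⟨y, rfl⟩ := exists_eq_nsmul_of_coordMod_eq_zero B hx
    exact hk y
  let T' : (ι → ZMod q) →+ A := (coordMod B q).liftOfSurjective (coordMod_surjective B q) ⟨π, hker⟩
  have hT' (x : G) : T' (coordMod B q x) = π x :=
    AddMonoidHom.liftOfRightInverse_comp_apply _ _ _ _ x
  have hTs : Function.Surjective T' := fun y => by
    obtain ⟨x, rfl⟩ := hπ y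
    exact ⟨_, hT' x⟩
  set Tb : Finset (ι → ZMod q) := Finset.univ.filter fun r => T' r ∈ s
  have hcard := card_preimage_of_surjective T' hTs s
  have hcount : ((coordBox B H).filter (· ∈ T)).card = ∑ r ∈ Tb,
      ∏ i, ((Finset.Ico (-(H : ℤ)) H).filter fun t : ℤ => (t : ZMod q) = r i).card := by
    rw [Finset.card_eq_sum_card_fiberwise (f := coordMod B q) (t := Tb)]
    · refine Finset.sum_congr rfl fun r hr => ?_
      rw [← card_coordBox_filter_coordMod B]
      congr 1
      ext x
      simp only [Finset.mem_filter]
      refine ⟨fun h => ⟨h.1.1, h.2⟩, fun h => ⟨⟨h.1, ?_⟩, h.2⟩⟩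
      rw [hT, ← hT', h.2]
      exact (Finset.mem_filter.1 hr).2
    · intro x hx
      have := (hT x).1 (Finset.mem_filter.1 hx).2
      simpa [Tb, hT'] using this
  have hqR : (0 : ℝ) < q := by exact_mod_cast hq
  have hA : (0 : ℝ) < Fintype.card A := by exact_mod_cast Fintype.card_pos
  have hcardR : (Tb.card : ℝ) = s.card / Fintype.card A * q ^ Fintype.card ι := by
    have h : (Tb.card : ℝ) * Fintype.card A = s.card * q ^ Fintype.card ι := by
      have := hcard
      simp only [Fintype.card_pi, ZMod.card, Finset.prod_const, Finset.card_univ] at this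
      exact_mod_cast this
    field_simp
    linarith
  have hcountR : (((coordBox B H).filter (· ∈ T)).card : ℝ) * q ^ Fintype.card ι =
      ∑ r ∈ Tb, ∏ i, (q * ((Finset.Ico (-(H : ℤ)) H).filter
        fun t : ℤ => (t : ZMod q) = r i).card : ℝ) := by
    rw [hcount, Nat.cast_sum, Finset.sum_mul]
    refine Finset.sum_congr rfl fun r _ => ?_
    rw [Finset.prod_mul_distrib, Finset.prod_const, Finset.card_univ, Nat.cast_prod, mul_comm]
  have hqn : (0 : ℝ) < q ^ Fintype.card ι := by positivity
  constructor
  · rw [← mul_le_mul_iff_left₀ hqn, hcountR]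
    calc _ ≤ ∑ r ∈ Tb, (2 * H + q : ℝ) ^ Fintype.card ι := by
          refine Finset.sum_le_sum fun r _ => ?_
          refine (Finset.prod_le_prod (fun i _ => by positivity)
            fun i _ => (card_Ico_filter_zmod hq H (r i)).2).trans ?_
          simp
      _ = _ := by rw [Finset.sum_const, nsmul_eq_mul, hcardR]; ring
  · intro h2
    have h2' : (q : ℝ) ≤ 2 * H := by exact_mod_cast h2
    rw [← mul_le_mul_iff_left₀ hqn, hcountR]
    calc _ = ∑ r ∈ Tb, (2 * H - q : ℝ) ^ Fintype.card ι := by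
          rw [Finset.sum_const, nsmul_eq_mul, hcardR]; ring
      _ ≤ _ := by
          refine Finset.sum_le_sum fun r _ => ?_
          refine le_trans ?_ (Finset.prod_le_prod (fun i _ => sub_nonneg.2 h2')
            fun i _ => (card_Ico_filter_zmod hq H (r i)).1)
          simp

end Counting

/-! ### Primes above rational primes -/

section Primes

variable {K : Type*} [Field K] [NumberField K]

theorem below_prime (v : HeightOneSpectrum (𝓞 K)) : (below v).Prime := by
  have : NeZero v.asIdeal := ⟨v.ne_bot⟩
  have := v.isPrime
  exact Nat.absNorm_under_prime v.asIdeal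

theorem below_mem (v : HeightOneSpectrum (𝓞 K)) : (below v : 𝓞 K) ∈ v.asIdeal := by
  have := Int.absNorm_under_mem v.asIdeal
  simpa [below] using this

theorem absNorm_pos (v : HeightOneSpectrum (𝓞 K)) : 0 < Ideal.absNorm v.asIdeal :=
  Nat.pos_of_ne_zero (by simpa [Ideal.absNorm_eq_zero_iff] using v.ne_bot)

theorem below_le_absNorm (v : HeightOneSpectrum (𝓞 K)) : below v ≤ Ideal.absNorm v.asIdeal :=
  Nat.le_of_dvd (absNorm_pos v) (Int.absNorm_under_dvd_absNorm v.asIdeal)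

theorem absNorm_span_natCast (p : ℕ) :
    Ideal.absNorm (Ideal.span {(p : 𝓞 K)}) = p ^ Module.finrank ℚ K := by
  rw [← RingOfIntegers.rank K]
  have h : Algebra.norm ℤ (p : 𝓞 K) = (p : ℤ) ^ Module.finrank ℤ (𝓞 K) := by
    simpa using Algebra.norm_algebraMap (S := 𝓞 K) (p : ℤ)
  rw [Ideal.absNorm_span_singleton, h, Int.natAbs_pow, Int.natAbs_natCast]

/-- Distinct maximal ideals are coprime, so their product divides `(x)`; then take norms. -/
theorem prod_absNorm_dvd {S : Finset (HeightOneSpectrum (𝓞 K))} {x : 𝓞 K}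
    (h : ∀ v ∈ S, x ∈ v.asIdeal) :
    ∏ v ∈ S, Ideal.absNorm v.asIdeal ∣ Ideal.absNorm (Ideal.span {x}) := by
  rw [← map_prod]
  refine Ideal.absNorm_dvd_absNorm_of_le (Ideal.dvd_iff_le.1 ?_)
  refine Finset.prod_dvd_of_coprime (fun v _ w _ hvw => ?_) fun v hv => ?_
  · have := v.isMaximal
    have := w.isMaximal
    exact Ideal.isCoprime_of_isMaximal fun h => hvw (HeightOneSpectrum.ext h)
  · rw [Ideal.dvd_iff_le, Ideal.span_singleton_le_iff_mem]
    exact h v hv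

theorem absNorm_le_below_pow (v : HeightOneSpectrum (𝓞 K)) :
    Ideal.absNorm v.asIdeal ≤ below v ^ Module.finrank ℚ K := by
  rw [← absNorm_span_natCast]
  refine Nat.le_of_dvd ?_ (by simpa using prod_absNorm_dvd (S := {v}) (by simpa using below_mem v))
  rw [absNorm_span_natCast]
  exact pow_pos (below_prime v).pos _

theorem finite_below_le (K : Type*) [Field K] [NumberField K] (M : ℝ) :
    {v : HeightOneSpectrum (𝓞 K) | (below v : ℝ) ≤ M}.Finite := by
  have := Ideal.finite_setOfPred_absNorm_le (S := 𝓞 K) (⌊M⌋₊ ^ Module.finrank ℚ K)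
  refine Set.Finite.of_finite_image (f := HeightOneSpectrum.asIdeal)
    (this.subset ?_) (fun _ _ _ _ h => HeightOneSpectrum.ext h)
  rintro _ ⟨v, hv, rfl⟩
  exact (absNorm_le_below_pow v).trans (Nat.pow_le_pow_left (Nat.le_floor hv) _)

/-- Each norm is at least `p`, and the product of the norms divides `N(p) = p^k`. -/
theorem card_le_finrank_of_below_eq {S : Finset (HeightOneSpectrum (𝓞 K))} {p : ℕ}
    (h : ∀ v ∈ S, below v = p) : S.card ≤ Module.finrank ℚ K := by
  rcases S.eq_empty_or_nonempty with rfl | ⟨v, hv⟩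
  · simp
  have hp : p.Prime := h v hv ▸ below_prime v
  have h1 := prod_absNorm_dvd (S := S) (x := (p : 𝓞 K)) fun w hw => h w hw ▸ below_mem w
  rw [absNorm_span_natCast] at h1
  have h2 := Nat.le_of_dvd (pow_pos hp.pos _) h1
  have h3 : p ^ S.card ≤ ∏ v ∈ S, Ideal.absNorm v.asIdeal :=
    Finset.pow_card_le_prod _ _ _ fun w hw => h w hw ▸ below_le_absNorm w
  exact (Nat.pow_le_pow_iff_right hp.one_lt).1 (h3.trans h2)

/-- Grouping by the rational prime below bounds the sum by `k ∑ p^(-2)`. -/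
theorem summable_inv_absNorm_sq (K : Type*) [Field K] [NumberField K] :
    Summable fun v : HeightOneSpectrum (𝓞 K) => ((Ideal.absNorm v.asIdeal : ℝ) ^ 2)⁻¹ := by
  have hs : Summable fun p : ℕ => ((p : ℝ) ^ 2)⁻¹ := Real.summable_nat_pow_inv.2 one_lt_two
  refine summable_of_sum_le (c := Module.finrank ℚ K * ∑' p : ℕ, ((p : ℝ) ^ 2)⁻¹)
    (fun v => by positivity) fun S => ?_
  calc _ ≤ ∑ v ∈ S, ((below v : ℝ) ^ 2)⁻¹ := by
        refine Finset.sum_le_sum fun v _ => ?_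
        have : (0 : ℝ) < below v := by exact_mod_cast (below_prime v).pos
        have h2 : (below v : ℝ) ≤ Ideal.absNorm v.asIdeal := by exact_mod_cast below_le_absNorm v
        gcongr
    _ = ∑ p ∈ S.image below, ∑ v ∈ S with below v = p, ((below v : ℝ) ^ 2)⁻¹ :=
        (Finset.sum_fiberwise_of_maps_to (fun v hv => Finset.mem_image_of_mem _ hv) _).symm
    _ ≤ ∑ p ∈ S.image below, Module.finrank ℚ K * ((p : ℝ) ^ 2)⁻¹ := by
        refine Finset.sum_le_sum fun p _ => ?_
        rw [Finset.sum_congr rfl fun v hv => by rw [(Finset.mem_filter.1 hv).2], Finset.sum_const,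
          nsmul_eq_mul]
        have := card_le_finrank_of_below_eq (S := S.filter fun v => below v = p) (p := p)
          fun v hv => (Finset.mem_filter.1 hv).2
        gcongr
    _ ≤ _ := by
        rw [← Finset.mul_sum]
        have := hs.sum_le_tsum (S.image below) fun p _ => by positivity
        gcongr

/-- Few primes above large rational primes divide an integer of bounded norm. -/
theorem exists_card_le_of_mem (K : Type*) [Field K] [NumberField K] {β : ℝ} (hβ : 0 < β) (C e : ℕ) :
    ∃ c : ℕ, ∀ H : ℕ, 1 ≤ H → ∀ x : 𝓞 K, x ≠ 0 → Ideal.absNorm (Ideal.span {x}) ≤ C * H ^ e →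
      ∀ S : Finset (HeightOneSpectrum (𝓞 K)),
        (∀ v ∈ S, (H : ℝ) ^ β < below v ∧ x ∈ v.asIdeal) → S.card ≤ c := by
  -- With `n > 1/β`, each prime in question satisfies `H < p^n`. Any `n * e` of them then contribute
  -- a product of at least `H^e`; more than `C` further ones contribute a factor of at least
  -- `2^(C+1) > C`, contradicting the norm bound. Using the trivial factor 2 keeps the bound uniform
  -- down to `H = 1`.
  obtain ⟨n, hn⟩ := exists_nat_gt (1 / β)
  refine ⟨n * e + C, fun H hH x hx hN S hS => ?_⟩
  by_contra! hlt
  have hH1 : (1 : ℝ) ≤ H := by exact_mod_cast hH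
  have hb (v) (hv : v ∈ S) : H < below v ^ n := by
    have h1 : (H : ℝ) ^ (1 : ℝ) ≤ (H : ℝ) ^ (β * n) := by
      refine Real.rpow_le_rpow_of_exponent_le hH1 ?_
      rw [div_lt_iff₀ hβ] at hn
      linarith
    have h2 : (H : ℝ) ^ (β * n) < (below v : ℝ) ^ n := by
      rw [Real.rpow_mul (by positivity), Real.rpow_natCast]
      refine pow_lt_pow_left₀ (hS v hv).1 (by positivity) ?_
      rintro rfl
      have : 0 < 1 / β := by positivity
      simp at hn
      linarith
    rw [Real.rpow_one] at h1
    exact_mod_cast h1.trans_lt h2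
  have h0 : 0 < Ideal.absNorm (Ideal.span {x}) :=
    Nat.pos_of_ne_zero (by simpa [Ideal.absNorm_eq_zero_iff] using hx)
  have hprod : ∏ v ∈ S, below v ≤ C * H ^ e :=
    (Finset.prod_le_prod' fun v _ => below_le_absNorm v).trans
      ((Nat.le_of_dvd h0 (prod_absNorm_dvd fun v hv => (hS v hv).2)).trans hN)
  obtain ⟨S₁, hS₁, hc₁⟩ := Finset.exists_subset_card_eq (s := S) (n := n * e) (by omega)
  have hc₂ : C < (S \ S₁).card := by rw [Finset.card_sdiff_of_subset hS₁]; omega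
  have h1 : H ^ e ≤ ∏ v ∈ S₁, below v := by
    have hn0 : n ≠ 0 := by
      rintro rfl
      have : 0 < 1 / β := by positivity
      simp at hn
      linarith
    rw [← Nat.pow_le_pow_iff_left hn0, ← Finset.prod_pow, ← pow_mul, mul_comm, ← hc₁]
    exact Finset.pow_card_le_prod _ _ _ fun v hv => (hb v (hS₁ hv)).le
  have h2 : 2 ^ (S \ S₁).card ≤ ∏ v ∈ S \ S₁, below v :=
    Finset.pow_card_le_prod _ _ _ fun v _ => (below_prime v).two_le
  rw [← Finset.prod_sdiff hS₁] at hprod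
  have h3 : 2 ^ (S \ S₁).card * H ^ e ≤ C * H ^ e := (Nat.mul_le_mul h2 h1).trans hprod
  have h4 : C < 2 ^ (S \ S₁).card := hc₂.trans Nat.lt_two_pow_self
  exact absurd (Nat.le_of_mul_le_mul_right h3 (pow_pos hH e)) (not_le.2 h4)

end Primes

/-! ### The local sets in the completion and their global description -/

section Completion

variable {K : Type*} [Field K] [NumberField K] (v : HeightOneSpectrum (𝓞 K))

theorem valued_algebraMap (a : 𝓞 K) :
    Valued.v ((algebraMap (𝓞 K) (v.adicCompletionIntegers K) a : v.adicCompletionIntegers K) :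
      v.adicCompletion K) = v.intValuation a := by
  rw [HeightOneSpectrum.algebraMap_adicCompletionIntegers_apply,
    HeightOneSpectrum.valuedAdicCompletion_eq_valuation']
  exact v.valuation_of_algebraMap a

/-- A uniformizer `π` can be taken in 𝔬 itself. An element of the ball is `π^j` times an integral
quotient, and the reverse inclusion is checked on generators. -/
theorem mem_map_pow_iff (j : ℕ) (x : v.adicCompletionIntegers K) :
    x ∈ v.asIdeal.map (algebraMap (𝓞 K) (v.adicCompletionIntegers K)) ^ j ↔
      Valued.v (x : v.adicCompletion K) ≤ WithZero.exp (-(j : ℤ)) := by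
  rw [← Ideal.map_pow]
  constructor
  · intro hx
    refine Submodule.span_induction (p := fun y _ =>
      Valued.v ((y : v.adicCompletionIntegers K) : v.adicCompletion K) ≤ WithZero.exp (-(j : ℤ)))
      ?_ (by simp) ?_ ?_ hx
    · rintro _ ⟨a, ha, rfl⟩
      rw [valued_algebraMap]
      exact (v.intValuation_le_pow_iff_mem a j).2 ha
    · intro y z _ _ hy hz
      exact (Valued.v.map_add _ _).trans (max_le hy hz)
    · intro c y _ hy
      change Valued.v ((c : v.adicCompletion K) * (y : v.adicCompletion K)) ≤ _
      rw [map_mul]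
      exact (mul_le_of_le_one_left' c.2).trans hy
  · intro hx
    obtain ⟨π, hπ⟩ := v.intValuation_exists_uniformizer
    have hπv : Valued.v ((algebraMap (𝓞 K) (v.adicCompletionIntegers K) (π ^ j) :
        v.adicCompletionIntegers K) : v.adicCompletion K) = WithZero.exp (-(j : ℤ)) := by
      rw [valued_algebraMap, map_pow, hπ, ← WithZero.exp_nsmul]
      simp
    set w : v.adicCompletionIntegers K := algebraMap (𝓞 K) (v.adicCompletionIntegers K) (π ^ j)
    have hw0 : (w : v.adicCompletion K) ≠ 0 := by
      intro h
      rw [h, map_zero] at hπv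
      exact WithZero.exp_ne_zero hπv.symm
    have hy : Valued.v ((x : v.adicCompletion K) / w) ≤ 1 := by
      rw [map_div₀, hπv]
      exact div_le_one_of_le₀ hx zero_le
    have e : x = w * (⟨(x : v.adicCompletion K) / w, hy⟩ : v.adicCompletionIntegers K) := by
      apply Subtype.ext
      change (x : v.adicCompletion K) = w * ((x : v.adicCompletion K) / w)
      rw [mul_div_cancel₀ _ hw0]
    rw [e]
    refine Ideal.mul_mem_right _ _ (Ideal.mem_map_of_mem _ ?_)
    rw [← v.intValuation_le_pow_iff_mem, map_pow, hπ, ← WithZero.exp_nsmul]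
    simp

theorem algebraMap_mem_map_pow_iff (j : ℕ) (a : 𝓞 K) :
    algebraMap (𝓞 K) (v.adicCompletionIntegers K) a ∈
      v.asIdeal.map (algebraMap (𝓞 K) (v.adicCompletionIntegers K)) ^ j ↔ a ∈ v.asIdeal ^ j := by
  rw [mem_map_pow_iff, valued_algebraMap]
  exact v.intValuation_le_pow_iff_mem a j

theorem algebraMap_mem_map_iff (a : 𝓞 K) :
    algebraMap (𝓞 K) (v.adicCompletionIntegers K) a ∈
      v.asIdeal.map (algebraMap (𝓞 K) (v.adicCompletionIntegers K)) ↔ a ∈ v.asIdeal := by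
  simpa using algebraMap_mem_map_pow_iff v 1 a

theorem map_asIdeal_isPrime :
    (v.asIdeal.map (algebraMap (𝓞 K) (v.adicCompletionIntegers K))).IsPrime := by
  have h (x : v.adicCompletionIntegers K) :
      x ∈ v.asIdeal.map (algebraMap (𝓞 K) (v.adicCompletionIntegers K)) ↔
        Valued.v (x : v.adicCompletion K) < 1 := by
    have := mem_map_pow_iff v 1 x
    rw [pow_one] at this
    rw [this, ← WithZero.lt_mul_exp_iff_le WithZero.exp_ne_zero, ← WithZero.exp_add]
    simp
  refine ⟨fun h1 => ?_, fun {x y} hxy => ?_⟩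
  · have := (h 1).1 (h1 ▸ Submodule.mem_top)
    simp at this
  · rw [h] at hxy ⊢
    rw [h]
    by_contra! H
    have e : Valued.v ((x * y : v.adicCompletionIntegers K) : v.adicCompletion K) =
        Valued.v (x : v.adicCompletion K) * Valued.v (y : v.adicCompletion K) := map_mul _ _ _
    rw [e] at hxy
    exact absurd hxy (not_lt.2 (one_le_mul H.1 H.2))

theorem isClopen_map_pow (j : ℕ) : IsClopen
    ((v.asIdeal.map (algebraMap (𝓞 K) (v.adicCompletionIntegers K)) ^ j :
      Ideal (v.adicCompletionIntegers K)) : Set (v.adicCompletionIntegers K)) := by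
  obtain ⟨π, hπ⟩ := v.intValuation_exists_uniformizer
  set w : v.adicCompletion K := ((algebraMap (𝓞 K) (v.adicCompletionIntegers K) (π ^ j) :
    v.adicCompletionIntegers K) : v.adicCompletion K)
  have hπv : Valued.v w = WithZero.exp (-(j : ℤ)) := by
    rw [valued_algebraMap, map_pow, hπ, ← WithZero.exp_nsmul]
    simp
  have hpos : (0 : ℤᵐ⁰) < Valued.v w := by rw [hπv]; exact WithZero.exp_pos
  have : ((v.asIdeal.map (algebraMap (𝓞 K) (v.adicCompletionIntegers K)) ^ j :
      Ideal (v.adicCompletionIntegers K)) : Set (v.adicCompletionIntegers K)) =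
      (fun x : v.adicCompletionIntegers K => (x : v.adicCompletion K) / w) ⁻¹'
        (Valued.integer (v.adicCompletion K) : Set (v.adicCompletion K)) := by
    ext x
    rw [SetLike.mem_coe, mem_map_pow_iff, ← hπv]
    change _ ↔ Valued.v ((x : v.adicCompletion K) / w) ≤ 1
    rw [map_div₀, div_le_one₀ hpos]
  rw [this]
  refine IsClopen.preimage ⟨Valued.isClosed_integer (v.adicCompletion K),
    Valued.isOpen_integer (v.adicCompletion K)⟩ ?_
  simp only [div_eq_mul_inv]
  exact continuous_subtype_val.mul continuous_const

variable {v} (d : ℕ)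

theorem continuous_shift {R : Type*} [CommRing R] [TopologicalSpace R] [IsTopologicalRing R] {d : ℕ}
    (b : R) : Continuous (shift (d := d) b) := by
  refine continuous_pi fun j => ?_
  simp only [shift_apply]
  fun_prop

variable (v)

/-- Finitely many coordinate conditions involving the clopen ideals 𝔭𝔬_𝔭 and 𝔭²𝔬_𝔭, pulled back
along a continuous translation. The point is that a clopen set has empty frontier. -/
theorem isClopen_localPiece (b : 𝓞 K) : IsClopen (localPiece K d v b) := by
  refine IsClopen.preimage ?_ (continuous_shift _)
  set Q := v.asIdeal.map (algebraMap (𝓞 K) (v.adicCompletionIntegers K)) with hQ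
  have h1 : IsClopen (Q : Set (v.adicCompletionIntegers K)) := by
    simpa using isClopen_map_pow v 1
  have e : eisensteinSet Q d = ((fun a => a 0) ⁻¹' ((Q ^ 2 : Ideal _) : Set _)ᶜ ∩
      (⋂ i, ⋂ (_ : i ≠ Fin.last d), (fun a => a i) ⁻¹' (Q : Set _))) ∩
      (fun a => a (Fin.last d)) ⁻¹' (Q : Set _)ᶜ := by
    ext a
    simp [eisensteinSet, and_assoc]
  rw [e]
  refine (((isClopen_map_pow v 2).compl.preimage (continuous_apply 0)).inter
    (isClopen_iInter_of_finite fun i => ?_)).inter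
    (h1.compl.preimage (continuous_apply (Fin.last d)))
  by_cases hi : i = Fin.last d
  · simp [hi, isClopen_univ]
  · simpa [hi] using h1.preimage (continuous_apply i)

theorem isClopen_finite : IsClopen ((shiftedEisensteinSystem K d).finite v) := by
  have : Finite (𝓞 K ⧸ v.asIdeal) := Ideal.finiteQuotientOfFreeOfNeBot _ v.ne_bot
  exact isClopen_iUnion_of_finite fun β => isClopen_localPiece v d β.out

theorem mem_localPiece_algebraMap_iff (b : 𝓞 K) (a : Fin (d + 1) → 𝓞 K) :
    (fun i => algebraMap (𝓞 K) (v.adicCompletionIntegers K) (a i)) ∈ localPiece K d v b ↔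
      shift b a ∈ eisensteinSet v.asIdeal d := by
  rw [localPiece, Set.mem_preimage, shift_map]
  exact map_mem_eisensteinSet_iff _ (algebraMap_mem_map_iff v) (algebraMap_mem_map_pow_iff v 2) _

theorem localPiece_eq {d : ℕ} (hd : 2 ≤ d) {b b' : 𝓞 K} (h : b - b' ∈ v.asIdeal) :
    localPiece K d v b = localPiece K d v b' := by
  ext a
  exact shift_mem_eisensteinSet_iff hd (by
    rw [← map_sub]; exact (algebraMap_mem_map_iff v _).2 h)

theorem disjoint_localPiece {d : ℕ} (hd : 1 ≤ d) {b b' : 𝓞 K} (h : b - b' ∉ v.asIdeal) :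
    Disjoint (localPiece K d v b) (localPiece K d v b') := by
  rw [Set.disjoint_left]
  intro a ha ha'
  have := sub_mem_of_shift_mem (map_asIdeal_isPrime v) hd ha ha'
  rw [← map_sub, algebraMap_mem_map_iff] at this
  exact h this

/-- The fixed representatives of 𝔬/𝔭 lose nothing, since the condition depends only on the class of
`b`. -/
theorem memFinite_iff {d : ℕ} (hd : 2 ≤ d) (a : Fin (d + 1) → 𝓞 K) :
    (shiftedEisensteinSystem K d).MemFinite v a ↔ ∃ b, shift b a ∈ eisensteinSet v.asIdeal d := by
  simp only [LocalSystem.MemFinite, shiftedEisensteinSystem, Set.mem_iUnion,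
    mem_localPiece_algebraMap_iff]
  refine ⟨fun ⟨β, h⟩ => ⟨_, h⟩, fun ⟨b, h⟩ => ⟨Ideal.Quotient.mk _ b, ?_⟩⟩
  refine (shift_mem_eisensteinSet_iff hd ?_).1 h
  rw [← Ideal.Quotient.eq, Ideal.Quotient.mk_out]

theorem powerDefect_mem_of_memFinite {d : ℕ} (hd : 2 ≤ d) {a : Fin (d + 1) → 𝓞 K}
    (h : (shiftedEisensteinSystem K d).MemFinite v a) (j : Fin (d + 1)) :
    powerDefect a j ∈ v.asIdeal := by
  obtain ⟨b, hb⟩ := (memFinite_iff v hd a).1 h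
  exact powerDefect_mem (by omega) hb.2.1 j

theorem last_notMem_of_memFinite {d : ℕ} (hd : 2 ≤ d) {a : Fin (d + 1) → 𝓞 K}
    (h : (shiftedEisensteinSystem K d).MemFinite v a) : a (Fin.last d) ∉ v.asIdeal := by
  obtain ⟨b, hb⟩ := (memFinite_iff v hd a).1 h
  simpa [shift_last] using hb.2.2

/-- If all defects vanished, `d^d a_d^(d-1) f(b)` would be a `d`-th power. But `a_d` is a 𝔭-unit and
`f(b)` has valuation exactly one, so the valuation of this product is `1` modulo `d`. The argument
also covers 𝔭 dividing `d`. -/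
theorem exists_powerDefect_ne_zero {d : ℕ} (hd : 2 ≤ d) {a : Fin (d + 1) → 𝓞 K}
    (h : (shiftedEisensteinSystem K d).MemFinite v a) : ∃ j, powerDefect a j ≠ 0 := by
  obtain ⟨b, h0, h1, h2⟩ := (memFinite_iff v hd a).1 h
  rw [shift_last] at h2
  by_contra! hj
  have e := sum_powerDefect a b
  simp only [hj, zero_mul, Finset.sum_const_zero] at e
  have e' := congrArg v.intValuation (sub_eq_zero.1 e.symm)
  have hlast : v.intValuation (a (Fin.last d)) = 1 := by
    refine le_antisymm (v.intValuation_le_one _) (not_lt.1 fun h => h2 ?_)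
    exact (v.intValuation_lt_one_iff_mem _).1 h
  have hzero : v.intValuation (shift b a 0) = WithZero.exp (-1 : ℤ) := by
    have hm := h1 0 (by simp [Fin.ext_iff]; omega)
    rw [← pow_one v.asIdeal, ← v.intValuation_le_pow_iff_mem] at hm
    rw [← v.intValuation_le_pow_iff_mem, not_le] at h0
    refine le_antisymm (by simpa using hm) ?_
    by_contra! hlt
    -- The valuation is discrete: strictly below `exp (-1)` means at most `exp (-2)`, which is
    -- membership in 𝔭².
    refine absurd h0 (not_lt.2 ((WithZero.lt_mul_exp_iff_le WithZero.exp_ne_zero).1 ?_))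
    rw [← WithZero.exp_add]
    simpa using hlt
  have hd0 : v.intValuation (d : 𝓞 K) ≠ 0 :=
    v.intValuation_ne_zero _ (Nat.cast_ne_zero.2 (by omega))
  rw [map_mul, map_mul, map_pow, map_pow, map_pow, hlast, hzero, one_pow, mul_one] at e'
  have e'' := congrArg WithZero.log e'
  rw [WithZero.log_mul (pow_ne_zero _ hd0) WithZero.exp_ne_zero, WithZero.log_pow, WithZero.log_pow,
    WithZero.log_exp, nsmul_eq_mul, nsmul_eq_mul] at e''
  have hdvd : (d : ℤ) ∣ 1 := by
    refine ⟨WithZero.log (v.intValuation (d : 𝓞 K)) - WithZero.log (v.intValuation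
      (d * a (Fin.last d) * b + a (Fin.ofNat _ (d - 1)))), ?_⟩
    rw [mul_sub]
    linarith
  have := Int.le_of_dvd one_pos hdvd
  omega

end Completion

/-! ### The local density, counted modulo 𝔭² -/

section LocalCount

theorem mem_eisensteinSet_iff {R : Type*} [CommRing R] {P : Ideal R} {d : ℕ} {a : Fin (d + 1) → R} :
    a ∈ eisensteinSet P d ↔
      a 0 ∉ P ^ 2 ∧ (∀ i, i ≠ Fin.last d → a i ∈ P) ∧ a (Fin.last d) ∉ P := Iff.rfl

theorem card_eisensteinSet {R : Type*} [CommRing R] [Fintype R] (P : Ideal R) {d : ℕ} (hd : 1 ≤ d) :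
    (Finset.univ.filter fun a : Fin (d + 1) → R => a ∈ eisensteinSet P d).card =
      (Nat.card P - Nat.card (P ^ 2 : Ideal R)) * Nat.card P ^ (d - 1) *
        (Fintype.card R - Nat.card P) := by
  have h0 : (0 : Fin (d + 1)) ≠ Fin.last d := by simp [Fin.ext_iff]; omega
  have cP (Q : Ideal R) : (Finset.univ.filter fun x => x ∈ Q).card = Nat.card Q := by
    rw [Nat.card_eq_fintype_card, Fintype.card_subtype]
  let t (i : Fin (d + 1)) : Finset R :=
    if i = 0 then (Finset.univ.filter fun x => x ∈ P) \ Finset.univ.filter fun x => x ∈ P ^ 2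
    else if i = Fin.last d then Finset.univ \ Finset.univ.filter fun x => x ∈ P
    else Finset.univ.filter fun x => x ∈ P
  have e : (Finset.univ.filter fun a : Fin (d + 1) → R => a ∈ eisensteinSet P d) =
      Fintype.piFinset t := by
    ext a
    simp only [Finset.mem_filter, Finset.mem_univ, true_and, Fintype.mem_piFinset,
      mem_eisensteinSet_iff, t]
    constructor
    · rintro ⟨h1, h2, h3⟩ i
      split_ifs with hi hi'
      · subst hi; simpa using ⟨h2 0 h0, h1⟩
      · subst hi'; simpa using h3
      · simpa using h2 i hi'
    · intro h
      have h1 := h 0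
      have h2 := h (Fin.last d)
      simp only [if_true, if_neg h0.symm, Finset.mem_sdiff, Finset.mem_filter, Finset.mem_univ,
        true_and] at h1 h2
      refine ⟨h1.2, fun i hi => ?_, h2⟩
      by_cases hi0 : i = 0
      · exact hi0 ▸ h1.1
      · simpa [hi0, hi] using h i
  rw [e, Fintype.card_piFinset, ← Finset.mul_prod_erase _ _ (Finset.mem_univ 0),
    ← Finset.mul_prod_erase _ _ (Finset.mem_erase.2 ⟨h0.symm, Finset.mem_univ (Fin.last d)⟩),
    Finset.prod_congr rfl (g := fun _ => Nat.card P), Finset.prod_const,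
    Finset.card_erase_of_mem (Finset.mem_erase.2 ⟨h0.symm, Finset.mem_univ _⟩),
    Finset.card_erase_of_mem (Finset.mem_univ _), Finset.card_univ, Fintype.card_fin]
  · have h1 : (t 0).card = Nat.card P - Nat.card (P ^ 2 : Ideal R) := by
      simp only [t, if_true]
      rw [Finset.card_sdiff_of_subset, cP, cP]
      intro x
      simpa using fun h => Ideal.pow_le_self two_ne_zero h
    have h2 : (t (Fin.last d)).card = Fintype.card R - Nat.card P := by
      simp only [t, if_neg h0.symm, if_true]
      rw [Finset.card_sdiff_of_subset (Finset.subset_univ _), cP, Finset.card_univ]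
    rw [h1, h2]
    simp only [Nat.add_sub_cancel]
    ring
  · intro i hi
    simp only [Finset.mem_erase, Finset.mem_univ, and_true] at hi
    simp only [t, if_neg hi.1, if_neg hi.2, cP]

/-- The set is a disjoint union, over the classes modulo `P`, of preimages of the Eisenstein set
under bijective translations. -/
theorem card_exists_shift_mem {R : Type*} [CommRing R] [Fintype R] (P : Ideal R) [hP : P.IsPrime]
    {d : ℕ} (hd : 2 ≤ d) :
    (Finset.univ.filter fun a : Fin (d + 1) → R => ∃ β, shift β a ∈ eisensteinSet P d).card =
      Nat.card (R ⧸ P) *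
        (Finset.univ.filter fun a : Fin (d + 1) → R => a ∈ eisensteinSet P d).card := by
  have : Fintype (R ⧸ P) := Fintype.ofFinite _
  have e : (Finset.univ.filter fun a : Fin (d + 1) → R => ∃ β, shift β a ∈ eisensteinSet P d) =
      (Finset.univ : Finset (R ⧸ P)).biUnion fun γ =>
        Finset.univ.filter fun a : Fin (d + 1) → R => shift γ.out a ∈ eisensteinSet P d := by
    ext a
    simp only [Finset.mem_filter, Finset.mem_univ, true_and, Finset.mem_biUnion]
    refine ⟨fun ⟨b, h⟩ => ⟨Ideal.Quotient.mk _ b, ?_⟩, fun ⟨γ, h⟩ => ⟨_, h⟩⟩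
    refine (shift_mem_eisensteinSet_iff hd ?_).1 h
    rw [← Ideal.Quotient.eq, Ideal.Quotient.mk_out]
  rw [e, Finset.card_biUnion, Finset.sum_const_nat (m := (Finset.univ.filter
    fun a : Fin (d + 1) → R => a ∈ eisensteinSet P d).card), Finset.card_univ,
    Nat.card_eq_fintype_card]
  · intro γ _
    refine Finset.card_bij (fun a _ => shift γ.out a) (by simp)
      (fun _ _ _ _ h => (shift_bijective _).1 h) fun a ha => ?_
    obtain ⟨b, rfl⟩ := (shift_bijective γ.out).2 a
    exact ⟨b, by simpa using ha, rfl⟩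
  · intro γ _ γ' _ hne
    rw [Function.onFun, Finset.disjoint_left]
    intro a ha ha'
    simp only [Finset.mem_filter, Finset.mem_univ, true_and] at ha ha'
    have := sub_mem_of_shift_mem hP (by omega) ha ha'
    rw [← Ideal.Quotient.eq, Ideal.Quotient.mk_out, Ideal.Quotient.mk_out] at this
    exact hne this

theorem mk_mem_map_sq_iff {R : Type*} [CommRing R] (I : Ideal R) (x : R) :
    Ideal.Quotient.mk (I ^ 2) x ∈
    I.map (Ideal.Quotient.mk (I ^ 2)) ↔ x ∈ I := by
  rw [← Ideal.mem_comap, Ideal.comap_map_of_surjective _ Ideal.Quotient.mk_surjective,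
    ← RingHom.ker_eq_comap_bot, Ideal.mk_ker, sup_eq_left.2 (Ideal.pow_le_self two_ne_zero)]

theorem map_mk_sq {R : Type*} [CommRing R] (I : Ideal R) :
    I.map (Ideal.Quotient.mk (I ^ 2)) ^ 2 = ⊥ := by
  rw [← Ideal.map_pow, Ideal.map_quotient_self]

variable {K : Type*} [Field K] [NumberField K] (v : HeightOneSpectrum (𝓞 K))

instance finite_quotient_sq : Finite (𝓞 K ⧸ v.asIdeal ^ 2) :=
  Ideal.finiteQuotientOfFreeOfNeBot _ (pow_ne_zero 2 v.ne_bot)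

noncomputable instance fintype_quotient_sq : Fintype (𝓞 K ⧸ v.asIdeal ^ 2) := Fintype.ofFinite _

/-- The coefficient vectors modulo `𝔭²` of the polynomials that are Eisenstein at `𝔭` after a
shift. -/
noncomputable def residueSet (d : ℕ) : Finset (Fin (d + 1) → 𝓞 K ⧸ v.asIdeal ^ 2) :=
  Finset.univ.filter fun a =>
    ∃ β, shift β a ∈ eisensteinSet (v.asIdeal.map (Ideal.Quotient.mk (v.asIdeal ^ 2))) d

/-- The reduction of a vector modulo `𝔭²`. -/
def reduceSq {m : ℕ} : (Fin m → 𝓞 K) →+ (Fin m → 𝓞 K ⧸ v.asIdeal ^ 2) :=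
  AddMonoidHom.mk' (fun a i => Ideal.Quotient.mk _ (a i)) fun _ _ => by funext i; simp

/-- The Eisenstein conditions see the coefficients only modulo 𝔭². In the quotient the square of the
image of 𝔭 is zero, so the condition on the constant term becomes `a_0 ≠ 0`. -/
theorem reduceSq_mem_residueSet_iff {d : ℕ} (hd : 2 ≤ d) (a : Fin (d + 1) → 𝓞 K) :
    reduceSq v a ∈ residueSet v d ↔ (shiftedEisensteinSystem K d).MemFinite v a := by
  have key (b : 𝓞 K) : shift (Ideal.Quotient.mk _ b) (reduceSq v a) ∈
      eisensteinSet (v.asIdeal.map (Ideal.Quotient.mk (v.asIdeal ^ 2))) d ↔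
        shift b a ∈ eisensteinSet v.asIdeal d := by
    rw [← map_mem_eisensteinSet_iff (Ideal.Quotient.mk (v.asIdeal ^ 2)) (mk_mem_map_sq_iff v.asIdeal)
      (fun x => by rw [map_mk_sq, Ideal.mem_bot, Ideal.Quotient.eq_zero_iff_mem]), ← shift_map]
    rfl
  rw [memFinite_iff v hd, residueSet, Finset.mem_filter]
  simp only [Finset.mem_univ, true_and]
  constructor
  · rintro ⟨β, h⟩
    obtain ⟨b, rfl⟩ := Ideal.Quotient.mk_surjective β
    exact ⟨b, (key b).1 h⟩
  · rintro ⟨b, h⟩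
    exact ⟨_, (key b).2 h⟩

/-- The measure of the set of shifted Eisenstein polynomials at `𝔭`. -/
noncomputable def localDensity (d : ℕ) (v : HeightOneSpectrum (𝓞 K)) : ℝ :=
  ((Ideal.absNorm v.asIdeal : ℝ) - 1) ^ 2 / (Ideal.absNorm v.asIdeal : ℝ) ^ (d + 1)

/-- There are `N` translates, each with `(N - 1) · N^(d-1) · (N² - N)` elements, among `N^(2(d+1))`
vectors. -/
theorem card_residueSet_div {d : ℕ} (hd : 2 ≤ d) :
    ((residueSet v d).card / Fintype.card (Fin (d + 1) → 𝓞 K ⧸ v.asIdeal ^ 2) : ℝ) =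
      localDensity d v := by
  set N := Ideal.absNorm v.asIdeal with hN
  set P := v.asIdeal.map (Ideal.Quotient.mk (v.asIdeal ^ 2)) with hP
  have hN0 : 0 < N := absNorm_pos v
  have hR : Fintype.card (𝓞 K ⧸ v.asIdeal ^ 2) = N ^ 2 := by
    rw [← Nat.card_eq_fintype_card, hN, ← map_pow, Ideal.absNorm_apply, Submodule.cardQuot_apply]
  have hq : Nat.card ((𝓞 K ⧸ v.asIdeal ^ 2) ⧸ P) = N := by
    rw [hN, Ideal.absNorm_apply, Submodule.cardQuot_apply]
    exact Nat.card_congr (DoubleQuot.quotQuotEquivQuotOfLE (Ideal.pow_le_self two_ne_zero)).toEquiv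
  have hPc : Nat.card P = N := by
    have := Submodule.card_eq_card_quotient_mul_card P
    rw [Nat.card_eq_fintype_card, hR, hq, pow_two] at this
    exact (Nat.eq_of_mul_eq_mul_left hN0 (by linarith))
  have hP2 : Nat.card (P ^ 2 : Ideal (𝓞 K ⧸ v.asIdeal ^ 2)) = 1 := by
    rw [hP, map_mk_sq]; simp
  have hprime : P.IsPrime := by
    have := v.isPrime
    refine Ideal.map_isPrime_of_surjective Ideal.Quotient.mk_surjective ?_
    rw [Ideal.mk_ker]
    exact Ideal.pow_le_self two_ne_zero
  rw [residueSet, card_exists_shift_mem P hd, card_eisensteinSet P (by omega), hq, hPc, hP2, hR,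
    Fintype.card_pi, Finset.prod_const, Finset.card_univ, Fintype.card_fin, hR, localDensity, ← hN]
  have h1 : 1 ≤ N := hN0
  have h2 : N ≤ N ^ 2 := by nlinarith
  obtain ⟨e, rfl⟩ := Nat.exists_eq_add_of_le hd
  push_cast [h1, h2]
  have : (N : ℝ) ≠ 0 := by positivity
  rw [show 2 + e - 1 = e + 1 by omega]
  field_simp
  ring

theorem card_residueSet_compl_div {d : ℕ} (hd : 2 ≤ d) :
    ((residueSet v d)ᶜ.card / Fintype.card (Fin (d + 1) → 𝓞 K ⧸ v.asIdeal ^ 2) : ℝ) =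
      1 - localDensity d v := by
  have h : (0 : ℝ) < Fintype.card (Fin (d + 1) → 𝓞 K ⧸ v.asIdeal ^ 2) := by
    exact_mod_cast Fintype.card_pos
  rw [← card_residueSet_div v hd, Finset.card_compl, Nat.cast_sub (Finset.card_le_univ _)]
  field_simp

end LocalCount

/-! ### Proportions in boxes and independence of distinct primes -/

section Boxes

variable {K : Type*} [Field K] [NumberField K] (E : IntegralBasis K) {m : ℕ}

theorem intBox_eq (H : ℕ) : intBox E H = coordBox E H := by
  ext x
  simp only [intBox, coordBox, Finset.mem_image, Finset.mem_map, Equiv.coe_toEmbedding]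
  simp [Module.Basis.equivFun_symm_apply]

theorem box_eq (m H : ℕ) : box E m H = coordBox (Pi.basis fun _ : Fin m => E) H := by
  ext x
  simp only [box, Fintype.mem_piFinset, intBox_eq, mem_coordBox, Pi.basis_repr]
  exact ⟨fun h i => h i.1 i.2, fun h i j => h ⟨i, j⟩⟩

theorem card_intBox (H : ℕ) : (intBox E H).card = (2 * H) ^ Module.finrank ℚ K := by
  rw [intBox_eq, card_coordBox, Fintype.card_fin]

theorem card_box (m H : ℕ) : ((box E m H).card : ℝ) = boxSize K m H := by
  rw [box, Fintype.card_piFinset, Finset.prod_const, card_intBox, Finset.card_univ,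
    Fintype.card_fin, boxSize, pow_mul]
  push_cast
  rfl

theorem boxSize_pos (m : ℕ) {H : ℕ} (hH : 1 ≤ H) : 0 < boxSize K m H := by
  have : (0 : ℝ) < H := by exact_mod_cast hH
  rw [boxSize]
  positivity

theorem boxSize_nonneg (m H : ℕ) : 0 ≤ boxSize K m H := by
  rw [boxSize]
  positivity

theorem boxRatio_nonneg (T : Set (Fin m → 𝓞 K)) (H : ℕ) : 0 ≤ boxRatio E T H :=
  div_nonneg (Nat.cast_nonneg _) (boxSize_nonneg _ _)

theorem boxRatio_eq {T : Set (Fin m → 𝓞 K)} (p : (Fin m → 𝓞 K) → Prop) [DecidablePred p]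
    (h : ∀ a, a ∈ T ↔ p a) (H : ℕ) :
    boxRatio E T H = ((box E m H).filter p).card / boxSize K m H := by
  rw [boxRatio]
  congr 3
  ext a
  simp only [Finset.mem_filter, h]

theorem boxRatio_mono {T T' : Set (Fin m → 𝓞 K)} (h : T ⊆ T') (H : ℕ) :
    boxRatio E T H ≤ boxRatio E T' H := by
  refine div_le_div_of_nonneg_right ?_ (boxSize_nonneg _ _)
  exact_mod_cast Finset.card_le_card fun a => by
    simpa only [Finset.mem_filter] using fun ha => And.imp_right (@h a) ha

theorem boxRatio_union_le (T T' : Set (Fin m → 𝓞 K)) (H : ℕ) :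
    boxRatio E (T ∪ T') H ≤ boxRatio E T H + boxRatio E T' H := by
  rw [boxRatio_eq E (T := T ∪ T') (fun a => a ∈ T ∨ a ∈ T') (fun a => Iff.rfl), boxRatio, boxRatio,
    ← add_div]
  refine div_le_div_of_nonneg_right ?_ (boxSize_nonneg _ _)
  rw [Finset.filter_or]
  exact_mod_cast Finset.card_union_le _ _

theorem boxRatio_compl (T : Set (Fin m → 𝓞 K)) {H : ℕ} (hH : 1 ≤ H) :
    boxRatio E Tᶜ H = 1 - boxRatio E T H := by
  have h := Finset.card_filter_add_card_filter_not (s := box E m H) (· ∈ T)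
  rw [eq_sub_iff_add_eq, boxRatio_eq E (T := Tᶜ) (fun a => ¬ a ∈ T) (fun a => Iff.rfl), boxRatio,
    ← add_div, div_eq_one_iff_eq (boxSize_pos m hH).ne', ← card_box E, ← h]
  push_cast
  rw [add_comm]

theorem boxRatio_le_one (T : Set (Fin m → 𝓞 K)) (H : ℕ) : boxRatio E T H ≤ 1 := by
  refine div_le_one_of_le₀ ?_ (boxSize_nonneg _ _)
  rw [← card_box E]
  exact_mod_cast Finset.card_filter_le _ _

theorem boxRatio_biUnion_le {ι : Type*} (S : Finset ι) (T : ι → Set (Fin m → 𝓞 K)) (H : ℕ) :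
    boxRatio E {a | ∃ i ∈ S, a ∈ T i} H ≤ ∑ i ∈ S, boxRatio E (T i) H := by
  rw [boxRatio_eq E (T := {a | ∃ i ∈ S, a ∈ T i}) (fun a => ∃ i ∈ S, a ∈ T i) fun a => Iff.rfl]
  simp only [boxRatio, ← Finset.sum_div]
  refine div_le_div_of_nonneg_right ?_ (boxSize_nonneg _ _)
  have : (box E m H).filter (fun a => ∃ i ∈ S, a ∈ T i) =
      S.biUnion fun i => (box E m H).filter (· ∈ T i) := by
    ext a
    simp only [Finset.mem_filter, Finset.mem_biUnion]
    tauto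
  rw [this]
  exact_mod_cast Finset.card_biUnion_le

theorem reduceSq_surjective (S : Finset (HeightOneSpectrum (𝓞 K)))
    (y : ∀ v : S, Fin m → 𝓞 K ⧸ v.1.asIdeal ^ 2) :
    ∃ a : Fin m → 𝓞 K, ∀ v : S, reduceSq v.1 a = y v := by
  have hco : Pairwise (Function.onFun IsCoprime fun v : S => v.1.asIdeal ^ 2) := by
    intro v w hvw
    have := v.1.isMaximal
    have := w.1.isMaximal
    exact (Ideal.isCoprime_of_isMaximal fun h =>
      hvw (Subtype.ext (HeightOneSpectrum.ext h))).pow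
  choose a ha using fun i => Ideal.pi_quotient_surjective hco fun v => y v i
  exact ⟨a, fun v => funext fun i => ha i v⟩

/-- The number of points of a box whose reductions at finitely many primes are prescribed. -/
theorem boxRatio_reduceSq (S : Finset (HeightOneSpectrum (𝓞 K)))
    (t : ∀ v : HeightOneSpectrum (𝓞 K), Finset (Fin m → 𝓞 K ⧸ v.asIdeal ^ 2))
    {T : Set (Fin m → 𝓞 K)} (hT : ∀ a, a ∈ T ↔ ∀ v ∈ S, reduceSq v a ∈ t v) {q : ℕ} (hq : 0 < q)
    (hqS : ∀ v ∈ S, (q : 𝓞 K) ∈ v.asIdeal ^ 2) {H : ℕ} (hH : 1 ≤ H) :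
    boxRatio E T H * boxSize K m H ≤
      (∏ v ∈ S, ((t v).card / Fintype.card (Fin m → 𝓞 K ⧸ v.asIdeal ^ 2) : ℝ)) *
        (2 * H + q) ^ (Module.finrank ℚ K * m) ∧
    (q ≤ 2 * H →
      (∏ v ∈ S, ((t v).card / Fintype.card (Fin m → 𝓞 K ⧸ v.asIdeal ^ 2) : ℝ)) *
        (2 * H - q) ^ (Module.finrank ℚ K * m) ≤
      boxRatio E T H * boxSize K m H) := by
  let π : (Fin m → 𝓞 K) →+ ∀ v : S, Fin m → 𝓞 K ⧸ v.1.asIdeal ^ 2 :=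
    AddMonoidHom.pi fun v => reduceSq v.1
  have hπ : Function.Surjective π := fun y => by
    obtain ⟨a, ha⟩ := reduceSq_surjective S y
    exact ⟨a, funext ha⟩
  have hk (x : Fin m → 𝓞 K) : π (q • x) = 0 := by
    funext v i
    change Ideal.Quotient.mk _ (q • x i) = 0
    rw [Ideal.Quotient.eq_zero_iff_mem, nsmul_eq_mul]
    exact Ideal.mul_mem_right _ _ (hqS v v.2)
  have h := card_coordBox_filter (Pi.basis fun _ : Fin m => E) π hπ hq hk
    (Fintype.piFinset fun v : S => t v.1) (T := T) (fun a => by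
      rw [hT, Fintype.mem_piFinset]
      exact ⟨fun h v => h v.1 v.2, fun h v hv => h ⟨v, hv⟩⟩) H
  rw [← box_eq, Fintype.card_piFinset, Fintype.card_pi, Fintype.card_sigma] at h
  simp only [Fintype.card_fin, Finset.sum_const, Finset.card_univ, smul_eq_mul, mul_comm m] at h
  have e : ((∏ v : S, (t v.1).card : ℕ) : ℝ) /
      ((∏ v : S, Fintype.card (Fin m → 𝓞 K ⧸ v.1.asIdeal ^ 2) : ℕ) : ℝ) =
      ∏ v ∈ S, ((t v).card / Fintype.card (Fin m → 𝓞 K ⧸ v.asIdeal ^ 2) : ℝ) := by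
    push_cast
    rw [← Finset.prod_div_distrib, ← Finset.prod_coe_sort S fun v : HeightOneSpectrum (𝓞 K) =>
      ((t v).card / Fintype.card (Fin m → 𝓞 K ⧸ v.asIdeal ^ 2) : ℝ)]
  rw [e] at h
  rwa [boxRatio, div_mul_cancel₀ _ (boxSize_pos m hH).ne']

/-- The modulus `q = ∏ p²` is at most `2H`, so `2H + q ≤ 2 · 2H`; this produces a factor that
depends neither on `S` nor on `H`. -/
theorem boxRatio_reduceSq_le (S : Finset (HeightOneSpectrum (𝓞 K)))
    (t : ∀ v : HeightOneSpectrum (𝓞 K), Finset (Fin m → 𝓞 K ⧸ v.asIdeal ^ 2))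
    {T : Set (Fin m → 𝓞 K)} (hT : ∀ a, a ∈ T ↔ ∀ v ∈ S, reduceSq v a ∈ t v) {H : ℕ} (hH : 1 ≤ H)
    (hS : ∏ v ∈ S, below v ^ 2 ≤ 2 * H) :
    boxRatio E T H ≤ 2 ^ (Module.finrank ℚ K * m) *
      ∏ v ∈ S, ((t v).card / Fintype.card (Fin m → 𝓞 K ⧸ v.asIdeal ^ 2) : ℝ) := by
  have h := (boxRatio_reduceSq E S t hT (q := ∏ v ∈ S, below v ^ 2)
    (Finset.prod_pos fun v _ => pow_pos (below_prime (K := K) v).pos _) (fun v hv => by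
      rw [← Finset.mul_prod_erase _ _ hv, Nat.cast_mul, Nat.cast_pow]
      exact Ideal.mul_mem_right _ (v.asIdeal ^ 2) (Ideal.pow_mem_pow (below_mem v) 2)) hH).1
  have hS' : ((∏ v ∈ S, below v ^ 2 : ℕ) : ℝ) ≤ 2 * H := by exact_mod_cast hS
  rw [← mul_le_mul_iff_left₀ (boxSize_pos (K := K) m hH)]
  refine h.trans ?_
  rw [boxSize, mul_right_comm, ← mul_pow, mul_comm]
  have : (0 : ℝ) ≤ ∏ v ∈ S, ((t v).card / Fintype.card (Fin m → 𝓞 K ⧸ v.asIdeal ^ 2) : ℝ) :=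
    Finset.prod_nonneg fun v _ => by positivity
  gcongr
  linarith

theorem tendsto_boxRatio_reduceSq (S : Finset (HeightOneSpectrum (𝓞 K)))
    (t : ∀ v : HeightOneSpectrum (𝓞 K), Finset (Fin m → 𝓞 K ⧸ v.asIdeal ^ 2))
    {T : Set (Fin m → 𝓞 K)} (hT : ∀ a, a ∈ T ↔ ∀ v ∈ S, reduceSq v a ∈ t v) :
    Tendsto (boxRatio E T) atTop
      (𝓝 (∏ v ∈ S, ((t v).card / Fintype.card (Fin m → 𝓞 K ⧸ v.asIdeal ^ 2) : ℝ))) := by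
  -- With `S` fixed, `q` is fixed, so both error factors `(1 ± q/(2H))^n` tend to one. A rational
  -- prime may occur in `q` several times, which is harmless.
  set q := ∏ v ∈ S, below v ^ 2
  have hq : 0 < q := Finset.prod_pos fun v _ => pow_pos (below_prime v).pos 2
  have hqS (v) (hv : v ∈ S) : (q : 𝓞 K) ∈ v.asIdeal ^ 2 := by
    simp only [q]
    rw [← Finset.mul_prod_erase _ _ hv, Nat.cast_mul, Nat.cast_pow]
    exact Ideal.mul_mem_right _ (v.asIdeal ^ 2) (Ideal.pow_mem_pow (below_mem v) 2)
  set δ := ∏ v ∈ S, ((t v).card / Fintype.card (Fin m → 𝓞 K ⧸ v.asIdeal ^ 2) : ℝ)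
  set n := Module.finrank ℚ K * m with hn
  have h0 : Tendsto (fun H : ℕ => (q : ℝ) / (2 * H)) atTop (𝓝 0) :=
    tendsto_const_nhds.div_atTop (tendsto_natCast_atTop_atTop.const_mul_atTop two_pos)
  have hlo : Tendsto (fun H : ℕ => δ * (1 - (q : ℝ) / (2 * H)) ^ n) atTop (𝓝 δ) := by
    simpa using ((h0.const_sub 1).pow n).const_mul δ
  have hhi : Tendsto (fun H : ℕ => δ * (1 + (q : ℝ) / (2 * H)) ^ n) atTop (𝓝 δ) := by
    simpa using ((h0.const_add 1).pow n).const_mul δ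
  refine tendsto_of_tendsto_of_tendsto_of_le_of_le' hlo hhi ?_ ?_
  · filter_upwards [eventually_ge_atTop 1, eventually_ge_atTop q] with H hH hqH
    have hHR : (0 : ℝ) < H := by exact_mod_cast hH
    rw [← mul_le_mul_iff_left₀ (boxSize_pos (K := K) m hH)]
    refine le_trans (le_of_eq ?_) ((boxRatio_reduceSq E S t hT hq hqS hH).2 (by omega))
    rw [boxSize, mul_assoc, ← mul_pow, sub_mul, one_mul, div_mul_cancel₀ _ (by positivity)]
  · filter_upwards [eventually_ge_atTop 1] with H hH
    have hHR : (0 : ℝ) < H := by exact_mod_cast hH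
    rw [← mul_le_mul_iff_left₀ (boxSize_pos (K := K) m hH)]
    refine ((boxRatio_reduceSq E S t hT hq hqS hH).1).trans (le_of_eq ?_)
    rw [boxSize, mul_assoc, ← mul_pow, add_mul, one_mul, div_mul_cancel₀ _ (by positivity)]

end Boxes

/-- Fubini for the coordinate `i₀`: each fibre has at most `B` points. The hypothesis starts from a
point of `T`, so only nonempty fibres need a bound. -/
theorem card_piFinset_filter_le {ι α : Type*} [Fintype ι] [DecidableEq ι] (s : Finset α) {T : Set (ι → α)} (i₀ : ι)
    {B : ℝ} (hB : 0 ≤ B)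
    (h : ∀ a ∈ Fintype.piFinset fun _ : ι => s, a ∈ T → ∀ U : Finset α,
      (∀ x ∈ U, x ∈ s ∧ Function.update a i₀ x ∈ T) → (U.card : ℝ) ≤ B) :
    (((Fintype.piFinset fun _ : ι => s).filter (· ∈ T)).card : ℝ) ≤
      B * (s.card : ℝ) ^ (Fintype.card ι - 1) := by
  let t : Finset ({i // i ≠ i₀} → α) := Fintype.piFinset fun _ => s
  have ht : t.card = s.card ^ (Fintype.card ι - 1) := by
    rw [Fintype.card_piFinset, Finset.prod_const, Finset.card_univ]
    congr 1
    simp [Fintype.card_subtype_compl]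
  rw [Finset.card_eq_sum_card_fiberwise (f := fun a (i : {i // i ≠ i₀}) => a i.1) (t := t)]
  · push_cast
    rw [← Nat.cast_pow, ← ht, mul_comm, ← nsmul_eq_mul, ← Finset.sum_const]
    refine Finset.sum_le_sum fun b _ => ?_
    set F := ((Fintype.piFinset fun _ : ι => s).filter (· ∈ T)).filter
      fun a => (fun i : {i // i ≠ i₀} => a i.1) = b with hF
    rcases F.eq_empty_or_nonempty with h0 | ⟨a, ha⟩
    · simpa [h0] using hB
    have hup (a') (ha' : a' ∈ F) : Function.update a i₀ (a' i₀) = a' := by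
      funext i
      by_cases hi : i = i₀
      · subst hi; simp
      · rw [Function.update_of_ne hi]
        exact congrFun ((Finset.mem_filter.1 ha).2.trans (Finset.mem_filter.1 ha').2.symm) ⟨i, hi⟩
    have hinj : Set.InjOn (fun a : ι → α => a i₀) F := by
      intro a₁ h₁ a₂ h₂ e
      rw [← hup a₁ h₁, ← hup a₂ h₂]
      simp only at e
      rw [e]
    rw [← Finset.card_image_of_injOn hinj]
    have ha' := Finset.mem_filter.1 (Finset.mem_filter.1 ha).1
    refine h a ha'.1 ha'.2 _ fun x hx => ?_
    obtain ⟨a', h', rfl⟩ := Finset.mem_image.1 hx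
    rw [hup a' h']
    have h'' := Finset.mem_filter.1 (Finset.mem_filter.1 h').1
    exact ⟨Fintype.mem_piFinset.1 h''.1 i₀, h''.2⟩
  · intro a ha
    have := Fintype.mem_piFinset.1 (Finset.mem_filter.1 ha).1
    exact Fintype.mem_piFinset.2 fun i => this i.1

/-! ### Residue classes modulo a prime, and the norm of a defect -/

section Large

variable {K : Type*} [Field K] [NumberField K] (E : IntegralBasis K)

theorem boxRatio_le_of_update {m : ℕ} {T : Set (Fin m → 𝓞 K)} (i₀ : Fin m) {B : ℝ} (hB : 0 ≤ B)
    {H : ℕ} (hH : 1 ≤ H)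
    (h : ∀ a ∈ box E m H, a ∈ T → ∀ U : Finset (𝓞 K),
      (∀ x ∈ U, x ∈ intBox E H ∧ Function.update a i₀ x ∈ T) →
        (U.card : ℝ) ≤ B * (2 * H) ^ Module.finrank ℚ K) :
    boxRatio E T H ≤ B := by
  have hHR : (0 : ℝ) < H := by exact_mod_cast hH
  have := card_piFinset_filter_le (intBox E H) i₀ (by positivity) h
  rw [boxRatio, div_le_iff₀ (boxSize_pos m hH)]
  refine this.trans (le_of_eq ?_)
  have hm : m = m - 1 + 1 := by have := i₀.2; omega
  rw [card_intBox, Fintype.card_fin, boxSize, mul_assoc]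
  conv_rhs => rw [hm]
  push_cast
  ring

/-- Some basis element `e_j` is not in 𝔭. With the other coordinates fixed, a difference `(x - y)
e_j ∈ 𝔭` forces `p ∣ x - y`. Only `1/p` is gained instead of `1/N`, which suffices for the
large-prime estimate. -/
theorem card_intBox_class_le (v : HeightOneSpectrum (𝓞 K)) {H : ℕ} (hH : 1 ≤ H) (U : Finset (𝓞 K))
    (hU : U ⊆ intBox E H) (h : ∀ x ∈ U, ∀ y ∈ U, x - y ∈ v.asIdeal) :
    (U.card : ℝ) ≤ (1 / below v + 1 / (2 * H)) * (2 * H) ^ Module.finrank ℚ K := by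
  have hHR : (0 : ℝ) < H := by exact_mod_cast hH
  have hp : (0 : ℝ) < below v := by exact_mod_cast (below_prime v).pos
  obtain ⟨j, hj⟩ : ∃ j, E j ∉ v.asIdeal := by
    by_contra! hall
    refine v.isPrime.ne_top ((Ideal.eq_top_iff_one _).2 ?_)
    rw [← E.sum_repr 1]
    exact sum_mem fun j _ => by rw [zsmul_eq_mul]; exact Ideal.mul_mem_left _ _ (hall j)
  obtain ⟨T, hT⟩ : ∃ T : Set (Fin (Module.finrank ℚ K) → ℤ), ∀ c, c ∈ T ↔ E.equivFun.symm c ∈ U :=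
    ⟨{c | E.equivFun.symm c ∈ U}, fun _ => Iff.rfl⟩
  have key := card_piFinset_filter_le (Finset.Ico (-(H : ℤ)) H) (T := T) j
    (B := (2 * H + below v) / below v) (by positivity) (by
      intro c _ hc W hW
      rw [le_div_iff₀ hp, mul_comm]
      refine le_trans ?_ (card_Ico_filter_zmod (below_prime v).pos H (c j : ZMod (below v))).2
      gcongr
      intro x hx
      rw [Finset.mem_filter]
      refine ⟨(hW x hx).1, ?_⟩
      have h1 := h _ ((hT _).1 (hW x hx).2) _ ((hT _).1 hc)
      have e : E.equivFun.symm (Function.update c j x) - E.equivFun.symm c = (x - c j) • E j := by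
        rw [← map_sub, Module.Basis.equivFun_symm_apply, Finset.sum_eq_single j]
        · simp
        · intro i _ hi; simp [hi]
        · simp
      have h1' : ((x - c j : ℤ) : 𝓞 K) * E j ∈ v.asIdeal := by
        rw [← zsmul_eq_mul, ← e]
        convert h1
      have h2 := (v.isPrime.mem_or_mem h1').resolve_right hj
      have h3 : x - c j ∈ v.asIdeal.under ℤ := by simpa [Ideal.mem_comap] using h2
      rw [← sub_eq_zero, ← Int.cast_sub, ZMod.intCast_zmod_eq_zero_iff_dvd]
      rwa [← Int.ideal_span_absNorm_eq_self (v.asIdeal.under ℤ), Ideal.mem_span_singleton] at h3)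
  have hk : Module.finrank ℚ K = Module.finrank ℚ K - 1 + 1 := by
    have := Module.finrank_pos (R := ℚ) (M := K)
    omega
  have hI : ((Finset.Ico (-(H : ℤ)) H).card : ℝ) = 2 * H := by
    rw [Int.card_Ico]
    have : ((H : ℤ) - -(H : ℤ)).toNat = 2 * H := by omega
    rw [this]; push_cast; rfl
  refine le_trans (Nat.cast_le.2 ?_) (key.trans (le_of_eq ?_))
  · refine Finset.card_le_card_of_injOn E.equivFun (fun x hx => ?_) E.equivFun.injective.injOn
    rw [Finset.mem_coe, Finset.mem_filter]
    have hx' := hU hx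
    rw [intBox_eq, mem_coordBox] at hx'
    refine ⟨Fintype.mem_piFinset.2 hx', ?_⟩
    rwa [hT, LinearEquiv.symm_apply_apply]
  · rw [Fintype.card_fin, hI]
    conv_rhs => rw [hk, pow_succ]
    field_simp

theorem exists_embedding_bound : ∃ A : ℝ, 1 ≤ A ∧ ∀ H : ℕ, ∀ x ∈ intBox E H, ∀ σ : K →ₐ[ℚ] ℂ,
    ‖σ (x : K)‖ ≤ A * H := by
  have hnn : ∀ σ : K →ₐ[ℚ] ℂ, 0 ≤ ∑ j, ‖σ (E j : K)‖ := fun σ => by positivity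
  refine ⟨1 + ∑ σ : K →ₐ[ℚ] ℂ, ∑ j, ‖σ (E j : K)‖, ?_, fun H x hx σ => ?_⟩
  · simpa using Finset.sum_nonneg fun σ _ => hnn σ
  rw [intBox_eq, mem_coordBox] at hx
  have e : σ (x : K) = ∑ j, (E.repr x j : ℂ) * σ (E j : K) := by
    conv_lhs => rw [← E.sum_repr x]
    simp
  calc ‖σ (x : K)‖ ≤ ∑ j, ‖(E.repr x j : ℂ) * σ (E j : K)‖ := e ▸ norm_sum_le _ _
    _ ≤ ∑ j, H * ‖σ (E j : K)‖ := by
        refine Finset.sum_le_sum fun j _ => ?_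
        rw [norm_mul, Complex.norm_intCast]
        have := Finset.mem_Ico.1 (hx j)
        have h2 : |((E.repr x j : ℤ) : ℝ)| ≤ H := by
          rw [← Int.cast_abs]
          exact_mod_cast abs_le.2 ⟨this.1, this.2.le⟩
        gcongr
    _ = (∑ j, ‖σ (E j : K)‖) * H := by rw [← Finset.mul_sum, mul_comm]
    _ ≤ _ := by
        have := Finset.single_le_sum (fun σ _ => hnn σ) (Finset.mem_univ σ)
        gcongr
        linarith

/-- A defect is homogeneous of degree `d` in the coefficients, so each of its `k` conjugates is
`O(H^d)`, and the norm is their product. -/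
theorem exists_absNorm_powerDefect_le {d : ℕ} (hd : 1 ≤ d) : ∃ C : ℕ, ∀ H : ℕ, 1 ≤ H →
    ∀ a ∈ box E (d + 1) H, ∀ j, Ideal.absNorm (Ideal.span {powerDefect a j}) ≤
      C * H ^ (d * Module.finrank ℚ K) := by
  obtain ⟨A, hA, hb⟩ := exists_embedding_bound E
  obtain ⟨C, hC⟩ := exists_nat_ge (((d ^ d + 2 ^ d * d ^ d) * A ^ d : ℝ) ^ Module.finrank ℚ K)
  refine ⟨C, fun H hH a ha j => ?_⟩
  have hHR : (1 : ℝ) ≤ H := by exact_mod_cast hH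
  have ha' (i) : a i ∈ intBox E H := Fintype.mem_piFinset.1 ha i
  have key (σ : K →ₐ[ℚ] ℂ) : ‖σ (powerDefect a j : 𝓞 K)‖ ≤
      (d ^ d + 2 ^ d * d ^ d) * A ^ d * (H : ℝ) ^ d := by
    have hB (i) : ‖σ (a i : K)‖ ≤ A * H := hb H _ (ha' i) σ
    have e : σ (powerDefect a j : 𝓞 K) = powerDefect (fun i => σ (a i : K)) j :=
      powerDefect_map ((σ : K →+* ℂ).comp (algebraMap (𝓞 K) K)) a j
    have hj : (j : ℕ) ≤ d := Nat.lt_succ_iff.1 j.2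
    have hA0 : 0 ≤ A * H := by positivity
    have h1 : ‖(d : ℂ) ^ d * σ (a (Fin.last d)) ^ (d - 1) * σ (a j)‖ ≤ d ^ d * (A * H) ^ d := by
      rw [norm_mul, norm_mul, norm_pow, norm_pow, Complex.norm_natCast, mul_assoc]
      refine mul_le_mul_of_nonneg_left ?_ (by positivity)
      calc _ ≤ (A * H) ^ (d - 1) * (A * H) := by gcongr <;> apply hB
        _ = _ := by rw [← pow_succ, Nat.sub_add_cancel hd]
    have h2 : ‖(d.choose j : ℂ) * (d * σ (a (Fin.last d))) ^ (j : ℕ) *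
        σ (a (Fin.ofNat _ (d - 1))) ^ (d - (j : ℕ))‖ ≤ 2 ^ d * (d ^ d * (A * H) ^ d) := by
      rw [norm_mul, norm_mul, norm_pow, norm_pow, norm_mul, Complex.norm_natCast,
        Complex.norm_natCast, mul_assoc, mul_pow, mul_assoc]
      have h3 : (d.choose j : ℝ) ≤ 2 ^ d := by exact_mod_cast Nat.choose_le_two_pow _ _
      have h4 : (d : ℝ) ^ (j : ℕ) ≤ d ^ d := pow_le_pow_right₀ (by exact_mod_cast hd) hj
      have h5 : ‖σ (a (Fin.last d))‖ ^ (j : ℕ) * ‖σ (a (Fin.ofNat _ (d - 1)))‖ ^ (d - (j : ℕ)) ≤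
          (A * H) ^ d := by
        calc _ ≤ (A * H) ^ (j : ℕ) * (A * H) ^ (d - (j : ℕ)) := by gcongr <;> apply hB
          _ = _ := by rw [← pow_add, Nat.add_sub_cancel' hj]
      gcongr
    rw [e, powerDefect]
    refine (norm_sub_le _ _).trans ((add_le_add h1 h2).trans (le_of_eq ?_))
    ring
  have hnorm : (Ideal.absNorm (Ideal.span {powerDefect a j}) : ℝ) =
      ∏ σ : K →ₐ[ℚ] ℂ, ‖σ (powerDefect a j : 𝓞 K)‖ := by
    rw [← norm_prod, ← Algebra.norm_eq_prod_embeddings ℚ ℂ, ← Algebra.coe_norm_int,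
      Ideal.absNorm_span_singleton, eq_ratCast, Rat.cast_intCast, Complex.norm_intCast,
      Nat.cast_natAbs, Int.cast_abs]
  have : (Ideal.absNorm (Ideal.span {powerDefect a j}) : ℝ) ≤
      C * H ^ (d * Module.finrank ℚ K) := by
    rw [hnorm]
    refine (Finset.prod_le_prod (fun _ _ => norm_nonneg _) fun σ _ => key σ).trans ?_
    rw [Finset.prod_const, Finset.card_univ, AlgHom.card, mul_pow, pow_mul]
    gcongr
  exact_mod_cast this

end Large

/-! ### Dependence of a defect on a single coefficient -/

section PowerDefectUpdate

variable {R : Type*} [CommRing R] {d : ℕ}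

theorem powerDefect_update_of_ne (a : Fin (d + 1) → R) {i j : Fin (d + 1)} (hij : j ≠ i)
    (hl : i ≠ Fin.last d) (hp : i ≠ Fin.ofNat _ (d - 1)) (x : R) :
    powerDefect (Function.update a i x) j = powerDefect a j := by
  simp only [powerDefect, Function.update_of_ne hij, Function.update_of_ne hl.symm,
    Function.update_of_ne hp.symm]

theorem powerDefect_update_sub (a : Fin (d + 1) → R) {i : Fin (d + 1)}
    (hl : i ≠ Fin.last d) (hp : i ≠ Fin.ofNat _ (d - 1)) (x y : R) :
    powerDefect (Function.update a i x) i - powerDefect (Function.update a i y) i =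
      (d : R) ^ d * a (Fin.last d) ^ (d - 1) * (x - y) := by
  simp only [powerDefect, Function.update_self, Function.update_of_ne hl.symm,
    Function.update_of_ne hp.symm]
  ring

end PowerDefectUpdate

/-! ### Rarity of vectors that are Eisenstein at a large prime -/

section Large

variable {K : Type*} [Field K] [NumberField K] (E : IntegralBasis K) {d : ℕ}

theorem finite_setOf_mem {x : 𝓞 K} (hx : x ≠ 0) :
    {v : HeightOneSpectrum (𝓞 K) | x ∈ v.asIdeal}.Finite := by
  refine (finite_below_le K (Ideal.absNorm (Ideal.span {x}))).subset fun v hv => ?_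
  have h0 : 0 < Ideal.absNorm (Ideal.span {x}) :=
    Nat.pos_of_ne_zero (by simpa [Ideal.absNorm_eq_zero_iff] using hx)
  have h1 := Nat.le_of_dvd h0 (prod_absNorm_dvd (S := {v}) (by simpa using hv))
  rw [Finset.prod_singleton] at h1
  have h2 : (below v : ℝ) ≤ Ideal.absNorm (Ideal.span {x}) := by
    exact_mod_cast (below_le_absNorm v).trans h1
  exact h2

/-- One nonzero defect lies in all of these primes at once. -/
theorem finite_setOf_memFinite (hd : 2 ≤ d) (a : Fin (d + 1) → 𝓞 K) :
    {v | (shiftedEisensteinSystem K d).MemFinite v a}.Finite := by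
  rcases Set.eq_empty_or_nonempty {v | (shiftedEisensteinSystem K d).MemFinite v a} with h | ⟨v, hv⟩
  · rw [h]; exact Set.finite_empty
  obtain ⟨j, hj⟩ := exists_powerDefect_ne_zero v hd hv
  exact (finite_setOf_mem hj).subset fun w hw => powerDefect_mem_of_memFinite w hd hw j

theorem exists_card_le_of_memFinite (hd : 2 ≤ d) {β : ℝ} (hβ : 0 < β) :
    ∃ c : ℕ, ∀ H : ℕ, 1 ≤ H → ∀ a ∈ box E (d + 1) H, ∀ S : Finset (HeightOneSpectrum (𝓞 K)),
      (∀ v ∈ S, (H : ℝ) ^ β < below v ∧ (shiftedEisensteinSystem K d).MemFinite v a) →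
        S.card ≤ c := by
  obtain ⟨C, hC⟩ := exists_absNorm_powerDefect_le E (d := d) (by omega)
  obtain ⟨c, hc⟩ := exists_card_le_of_mem K hβ C (d * Module.finrank ℚ K)
  refine ⟨c, fun H hH a ha S hS => ?_⟩
  rcases S.eq_empty_or_nonempty with rfl | ⟨v, hv⟩
  · simp
  obtain ⟨j, hj⟩ := exists_powerDefect_ne_zero v hd (hS v hv).2
  exact hc H hH _ hj (hC H hH a ha j) S fun w hw =>
    ⟨(hS w hw).1, powerDefect_mem_of_memFinite w hd (hS w hw).2 j⟩

theorem natCast_notMem {v : HeightOneSpectrum (𝓞 K)} {n : ℕ} (hn : 0 < n) (h : n < below v) :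
    (n : 𝓞 K) ∉ v.asIdeal := by
  intro hm
  have h3 : (n : ℤ) ∈ v.asIdeal.under ℤ := by simpa [Ideal.mem_comap] using hm
  rw [← Int.ideal_span_absNorm_eq_self (v.asIdeal.under ℤ), Ideal.mem_span_singleton,
    Int.natCast_dvd_natCast] at h3
  exact absurd (Nat.le_of_dvd hn h3) (not_le.2 h)

/-- The vectors with vanishing defect at a given place have density zero. -/
theorem boxRatio_powerDefect_eq_zero_le (hd : 1 ≤ d) {i : Fin (d + 1)} (hl : i ≠ Fin.last d)
    (hp : i ≠ Fin.ofNat _ (d - 1)) {H : ℕ} (hH : 1 ≤ H) :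
    boxRatio E {a : Fin (d + 1) → 𝓞 K | a (Fin.last d) ≠ 0 ∧ powerDefect a i = 0} H ≤
      1 / (2 * H) := by
  have hHR : (1 : ℝ) ≤ H := by exact_mod_cast hH
  refine boxRatio_le_of_update E i (by positivity) hH fun a _ ha U hU => ?_
  have h1 : U.card ≤ 1 := by
    refine Finset.card_le_one.2 fun x hx y hy => ?_
    have e := powerDefect_update_sub a hl hp x y
    rw [(hU x hx).2.2, (hU y hy).2.2, sub_zero, eq_comm, mul_eq_zero] at e
    refine sub_eq_zero.1 (e.resolve_left ?_)
    exact mul_ne_zero (pow_ne_zero _ (Nat.cast_ne_zero.2 (by omega))) (pow_ne_zero _ ha.1)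
  refine (Nat.cast_le.2 h1).trans ?_
  have hk : Module.finrank ℚ K = Module.finrank ℚ K - 1 + 1 := by
    have := Module.finrank_pos (R := ℚ) (M := K)
    omega
  rw [hk, pow_succ, mul_comm, mul_assoc, mul_one_div_cancel (by positivity), mul_one, Nat.cast_one]
  exact one_le_pow₀ (by linarith)

/-- Vary `a_i` alone. The defect at `j` stays fixed, so the candidate primes form a fixed set of
bounded size; for each of them the affine defect at `i` pins `a_i` to one class modulo 𝔭. -/
theorem exists_boxRatio_powerDefect_mem_le (hd : 1 ≤ d) {i j : Fin (d + 1)} (hij : j ≠ i)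
    (hl : i ≠ Fin.last d) (hp : i ≠ Fin.ofNat _ (d - 1)) {β : ℝ} (hβ : 0 < β) :
    ∃ c : ℕ, ∀ H : ℕ, 1 ≤ H →
      boxRatio E {a : Fin (d + 1) → 𝓞 K | powerDefect a j ≠ 0 ∧ ∃ v : HeightOneSpectrum (𝓞 K),
        (H : ℝ) ^ β < below v ∧ d < below v ∧ powerDefect a j ∈ v.asIdeal ∧
          powerDefect a i ∈ v.asIdeal ∧ a (Fin.last d) ∉ v.asIdeal} H ≤
        c * (((H : ℝ) ^ β)⁻¹ + 1 / (2 * H)) := by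
  obtain ⟨C, hC⟩ := exists_absNorm_powerDefect_le E (d := d) hd
  obtain ⟨c, hc⟩ := exists_card_le_of_mem K hβ C (d * Module.finrank ℚ K)
  refine ⟨c, fun H hH => ?_⟩
  have hHR : (1 : ℝ) ≤ H := by exact_mod_cast hH
  refine boxRatio_le_of_update E i (by positivity) hH fun a habox ha U hU => ?_
  have hg := ha.1
  set V : Finset (HeightOneSpectrum (𝓞 K)) :=
    (finite_setOf_mem hg).toFinset.filter fun v => (H : ℝ) ^ β < below v ∧ d < below v with hV
  have hVc : V.card ≤ c := hc H hH _ hg (hC H hH a habox j) V fun v hv => by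
    simp only [hV, Finset.mem_filter, Set.Finite.mem_toFinset] at hv
    exact ⟨hv.2.1, hv.1⟩
  have hsub : U ⊆ V.biUnion fun v => U.filter fun x =>
      powerDefect (Function.update a i x) i ∈ v.asIdeal ∧ a (Fin.last d) ∉ v.asIdeal := by
    intro x hx
    obtain ⟨_, _, v, h1, h2, h3, h4, h5⟩ := hU x hx
    rw [powerDefect_update_of_ne a hij hl hp] at h3
    rw [Function.update_of_ne hl.symm] at h5
    rw [Finset.mem_biUnion]
    exact ⟨v, Finset.mem_filter.2 ⟨(Set.Finite.mem_toFinset _).2 h3, h1, h2⟩,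
      Finset.mem_filter.2 ⟨hx, h4, h5⟩⟩
  have hcl (v) (hv : v ∈ V) : ((U.filter fun x => powerDefect (Function.update a i x) i ∈ v.asIdeal ∧
      a (Fin.last d) ∉ v.asIdeal).card : ℝ) ≤
        (((H : ℝ) ^ β)⁻¹ + 1 / (2 * H)) * (2 * H) ^ Module.finrank ℚ K := by
    have hv' := (Finset.mem_filter.1 hv).2
    refine (card_intBox_class_le E v hH _ (fun x hx => (hU x (Finset.mem_filter.1 hx).1).1)
      fun x hx y hy => ?_).trans ?_
    · have h1 := (Finset.mem_filter.1 hx).2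
      have h2 := (Finset.mem_filter.1 hy).2
      have h3 := sub_mem h1.1 h2.1
      rw [powerDefect_update_sub a hl hp] at h3
      have hprime := v.isPrime
      refine (hprime.mem_or_mem h3).resolve_left fun h4 => ?_
      rcases hprime.mem_or_mem h4 with h5 | h5
      · exact natCast_notMem (by omega) hv'.2 (hprime.mem_of_pow_mem _ h5)
      · exact h1.2 (hprime.mem_of_pow_mem _ h5)
    · have h0 : (0 : ℝ) < (H : ℝ) ^ β := by positivity
      rw [one_div (below v : ℝ)]
      have := inv_anti₀ h0 hv'.1.le
      gcongr
  calc (U.card : ℝ) ≤ ∑ v ∈ V, ((U.filter fun x => powerDefect (Function.update a i x) i ∈ v.asIdeal ∧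
        a (Fin.last d) ∉ v.asIdeal).card : ℝ) := by
        exact_mod_cast (Finset.card_le_card hsub).trans Finset.card_biUnion_le
    _ ≤ V.card * ((((H : ℝ) ^ β)⁻¹ + 1 / (2 * H)) * (2 * H) ^ Module.finrank ℚ K) := by
        rw [← nsmul_eq_mul, ← Finset.sum_const]
        exact Finset.sum_le_sum hcl
    _ ≤ _ := by
        rw [← mul_assoc]
        gcongr

/-- Polynomials that are Eisenstein at a large prime after a shift are rare. -/
theorem tendsto_boxRatio_memFinite_large (hd : 3 ≤ d) {β : ℝ} (hβ : 0 < β) :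
    Tendsto (fun H : ℕ => boxRatio E {a | ∃ v, (H : ℝ) ^ β < below v ∧
      (shiftedEisensteinSystem K d).MemFinite v a} H) atTop (𝓝 0) := by
  -- Two distinct indices below `d - 1` are needed, since the coefficients at `d - 1` and `d` enter
  -- every defect; this uses `d ≥ 3`.
  let i : Fin (d + 1) := ⟨d - 3, by omega⟩
  let j : Fin (d + 1) := ⟨d - 2, by omega⟩
  have e1 : ((Fin.ofNat (d + 1) (d - 1) : Fin (d + 1)) : ℕ) = d - 1 := by
    simp [Nat.mod_eq_of_lt (show d - 1 < d + 1 by omega)]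
  have hil : i ≠ Fin.last d := by simp [i, Fin.ext_iff]; omega
  have hjl : j ≠ Fin.last d := by simp [j, Fin.ext_iff]; omega
  have hip : i ≠ Fin.ofNat _ (d - 1) := by rw [Ne, Fin.ext_iff, e1]; simp only [i]; omega
  have hjp : j ≠ Fin.ofNat _ (d - 1) := by rw [Ne, Fin.ext_iff, e1]; simp only [j]; omega
  have hij : j ≠ i := by simp only [i, j, Ne, Fin.ext_iff]; omega
  obtain ⟨c, hc⟩ := exists_boxRatio_powerDefect_mem_le E (d := d) (by omega) hij hil hip hβ
  have hpow : Tendsto (fun H : ℕ => (H : ℝ) ^ β) atTop atTop :=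
    (tendsto_rpow_atTop hβ).comp tendsto_natCast_atTop_atTop
  have h2 : Tendsto (fun H : ℕ => 1 / (2 * (H : ℝ))) atTop (𝓝 0) :=
    tendsto_const_nhds.div_atTop (tendsto_natCast_atTop_atTop.const_mul_atTop two_pos)
  have hlim : Tendsto (fun H : ℕ => 1 / (2 * (H : ℝ)) +
      c * (((H : ℝ) ^ β)⁻¹ + 1 / (2 * H))) atTop (𝓝 0) := by
    simpa using h2.add ((hpow.inv_tendsto_atTop.add h2).const_mul (c : ℝ))
  refine squeeze_zero' (Eventually.of_forall fun H => boxRatio_nonneg E _ H) ?_ hlim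
  -- Once `H^β ≥ d`, the primes considered lie above `p > d`, so `d` is a unit modulo 𝔭.
  filter_upwards [eventually_ge_atTop 1, hpow.eventually_ge_atTop (d : ℝ)] with H hH hHd
  refine le_trans (boxRatio_mono E ?_ H) ((boxRatio_union_le E _ _ H).trans
    (add_le_add (boxRatio_powerDefect_eq_zero_le E (by omega) hjl hjp hH) (hc H hH)))
  rintro a ⟨v, hv, hva⟩
  have hlast := last_notMem_of_memFinite v (by omega) hva
  by_cases h0 : powerDefect a j = 0
  · exact Or.inl ⟨fun h => hlast (h ▸ zero_mem _), h0⟩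
  · exact Or.inr ⟨h0, v, hv, by exact_mod_cast hHd.trans_lt hv,
      powerDefect_mem_of_memFinite v (by omega) hva j,
      powerDefect_mem_of_memFinite v (by omega) hva i, hlast⟩

end Large

/-! ### Convergence of the series and the product of local densities -/

section LocalDensity

variable {K : Type*} [Field K] [NumberField K] {d : ℕ}

theorem two_le_absNorm (v : HeightOneSpectrum (𝓞 K)) : (2 : ℝ) ≤ Ideal.absNorm v.asIdeal := by
  exact_mod_cast (below_prime v).two_le.trans (below_le_absNorm v)

theorem localDensity_pos (v : HeightOneSpectrum (𝓞 K)) : 0 < localDensity d v := by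
  have h := two_le_absNorm v
  have : (0 : ℝ) < (Ideal.absNorm v.asIdeal : ℝ) - 1 := by linarith
  rw [localDensity]
  positivity

theorem localDensity_le (hd : 3 ≤ d) (v : HeightOneSpectrum (𝓞 K)) :
    localDensity d v ≤ ((Ideal.absNorm v.asIdeal : ℝ) ^ 2)⁻¹ := by
  have h := two_le_absNorm v
  set N : ℝ := ((Ideal.absNorm v.asIdeal : ℕ) : ℝ) with hN
  rw [localDensity, ← hN, ← one_div, div_le_div_iff₀ (by positivity) (by positivity), one_mul]
  calc (N - 1) ^ 2 * N ^ 2 ≤ N ^ 2 * N ^ 2 := by gcongr <;> linarith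
    _ = N ^ 4 := by ring
    _ ≤ N ^ (d + 1) := pow_le_pow_right₀ (by linarith) (by omega)

theorem localDensity_le_one (hd : 3 ≤ d) (v : HeightOneSpectrum (𝓞 K)) : localDensity d v ≤ 1 := by
  refine (localDensity_le hd v).trans (inv_le_one_of_one_le₀ (one_le_pow₀ ?_))
  linarith [two_le_absNorm v]

theorem summable_localDensity (K : Type*) [Field K] [NumberField K] (hd : 3 ≤ d) :
    Summable (localDensity (K := K) d) :=
  (summable_inv_absNorm_sq K).of_nonneg_of_le (fun v => (localDensity_pos v).le)
    (localDensity_le hd)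

theorem summable_localDensity_sq (K : Type*) [Field K] [NumberField K] (hd : 3 ≤ d) :
    Summable fun v : HeightOneSpectrum (𝓞 K) => localDensity d v ^ 2 := by
  refine (summable_localDensity K hd).of_nonneg_of_le (fun v => sq_nonneg _) fun v => ?_
  rw [pow_two]
  exact mul_le_of_le_one_left (localDensity_pos v).le (localDensity_le_one hd v)

theorem multipliable_one_sub_localDensity (K : Type*) [Field K] [NumberField K] (hd : 3 ≤ d) :
    Multipliable fun v : HeightOneSpectrum (𝓞 K) => 1 - localDensity d v := by
  simpa [sub_eq_add_neg] using
    Real.multipliable_one_add_of_summable (summable_localDensity K hd).neg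

theorem exists_heightOneSpectrum (K : Type*) [Field K] [NumberField K] :
    Nonempty (HeightOneSpectrum (𝓞 K)) := by
  obtain ⟨P, hP, hP'⟩ := Ring.not_isField_iff_exists_prime.1 (RingOfIntegers.not_isField K)
  exact ⟨⟨P, hP', hP⟩⟩

/-- All factors lie in `[0, 1]`, so the product is at most any single one of them, and that one is
below 1. -/
theorem tprod_one_sub_localDensity_lt_one (K : Type*) [Field K] [NumberField K] (hd : 3 ≤ d) :
    ∏' v : HeightOneSpectrum (𝓞 K), (1 - localDensity d v) < 1 := by
  obtain ⟨v₀⟩ := exists_heightOneSpectrum K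
  refine lt_of_le_of_lt (b := 1 - localDensity d v₀) ?_ (by linarith [localDensity_pos (d := d) v₀])
  refine le_of_tendsto (multipliable_one_sub_localDensity K hd).hasProd ?_
  filter_upwards [eventually_ge_atTop {v₀}] with S hS
  have hv₀ : v₀ ∈ S := hS (Finset.mem_singleton_self _)
  rw [← Finset.mul_prod_erase _ _ hv₀]
  refine mul_le_of_le_one_right (by linarith [localDensity_le_one hd v₀]) ?_
  exact Finset.prod_le_one (fun v _ => by linarith [localDensity_le_one hd v])
    fun v _ => by linarith [localDensity_pos (d := d) v]

end LocalDensity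

/-! ### Tail condition, moment hypotheses and density -/

section Tail

variable {K : Type*} [Field K] [NumberField K] (E : IntegralBasis K) {d : ℕ}

theorem tendsto_boxRatio_forall_memFinite (hd : 2 ≤ d) (S : Finset (HeightOneSpectrum (𝓞 K))) :
    Tendsto (boxRatio E {a | ∀ v ∈ S, (shiftedEisensteinSystem K d).MemFinite v a}) atTop
      (𝓝 (∏ v ∈ S, localDensity d v)) := by
  have := tendsto_boxRatio_reduceSq E S (fun v => residueSet v d)
    (T := {a | ∀ v ∈ S, (shiftedEisensteinSystem K d).MemFinite v a})
    (fun a => by simp only [reduceSq_mem_residueSet_iff _ hd]; rfl)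
  simpa only [card_residueSet_div _ hd] using this

theorem tendsto_boxRatio_forall_not_memFinite (hd : 2 ≤ d) (S : Finset (HeightOneSpectrum (𝓞 K))) :
    Tendsto (boxRatio E {a | ∀ v ∈ S, ¬ (shiftedEisensteinSystem K d).MemFinite v a}) atTop
      (𝓝 (∏ v ∈ S, (1 - localDensity d v))) := by
  have := tendsto_boxRatio_reduceSq E S (fun v => (residueSet v d)ᶜ)
    (T := {a | ∀ v ∈ S, ¬ (shiftedEisensteinSystem K d).MemFinite v a})
    (fun a => by simp only [Finset.mem_compl, reduceSq_mem_residueSet_iff _ hd]; rfl)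
  simpa only [card_residueSet_compl_div _ hd] using this

/-- The exponent `1/(2n)` is chosen so that for at most `n` primes the modulus `∏ p²` stays below
`H`. -/
theorem boxRatio_forall_memFinite_le (hd : 2 ≤ d) {n : ℕ} (hn : 1 ≤ n) {H : ℕ} (hH : 1 ≤ H)
    {S : Finset (HeightOneSpectrum (𝓞 K))} (hSn : S.card ≤ n)
    (hS : ∀ v ∈ S, (below v : ℝ) ≤ (H : ℝ) ^ (1 / (2 * n : ℝ))) :
    boxRatio E {a | ∀ v ∈ S, (shiftedEisensteinSystem K d).MemFinite v a} H ≤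
      2 ^ (Module.finrank ℚ K * (d + 1)) * ∏ v ∈ S, localDensity d v := by
  have hHR : (1 : ℝ) ≤ H := by exact_mod_cast hH
  have hnR : (0 : ℝ) < n := by exact_mod_cast hn
  have hprod : ∏ v ∈ S, below v ^ 2 ≤ H := by
    have h1 : (∏ v ∈ S, (below v : ℝ) ^ 2) ≤ H := by
      calc ∏ v ∈ S, (below v : ℝ) ^ 2 ≤ ∏ v ∈ S, (H : ℝ) ^ (1 / n : ℝ) := by
            refine Finset.prod_le_prod (fun _ _ => by positivity) fun v hv => ?_
            calc (below v : ℝ) ^ 2 ≤ ((H : ℝ) ^ (1 / (2 * n : ℝ))) ^ 2 := by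
                  have := hS v hv
                  gcongr
              _ = _ := by
                  rw [← Real.rpow_natCast, ← Real.rpow_mul (by positivity)]
                  congr 1
                  push_cast
                  field_simp
        _ = ((H : ℝ) ^ (1 / n : ℝ)) ^ S.card := by rw [Finset.prod_const]
        _ ≤ ((H : ℝ) ^ (1 / n : ℝ)) ^ n :=
            pow_le_pow_right₀ (Real.one_le_rpow hHR (by positivity)) hSn
        _ = H := by
            rw [← Real.rpow_natCast, ← Real.rpow_mul (by positivity),
              one_div_mul_cancel hnR.ne', Real.rpow_one]
    exact_mod_cast h1
  have := boxRatio_reduceSq_le E S (fun v => residueSet v d)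
    (T := {a | ∀ v ∈ S, (shiftedEisensteinSystem K d).MemFinite v a})
    (fun a => by simp only [reduceSq_mem_residueSet_iff _ hd]; rfl) hH (by omega)
  simpa only [card_residueSet_div _ hd] using this

/-- A bound for the upper density of the vectors lying in the local set of a prime above a rational
prime that is larger than `M`. -/
noncomputable def tailBound (K : Type*) [Field K] [NumberField K] (d M : ℕ) : ℝ :=
  2 ^ (Module.finrank ℚ K * (d + 1)) *
    ∑' v : HeightOneSpectrum (𝓞 K), if M < below v then localDensity d v else 0

theorem summable_ite_localDensity (hd : 3 ≤ d) (p : HeightOneSpectrum (𝓞 K) → Prop)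
    [DecidablePred p] :     Summable fun v => if p v then localDensity d v else 0 := by
  refine (summable_localDensity K hd).of_nonneg_of_le (fun v => ?_) fun v => ?_ <;>
    have := localDensity_pos (d := d) v <;> split_ifs <;> linarith

theorem tendsto_tailBound (K : Type*) [Field K] [NumberField K] (hd : 3 ≤ d) :
    Tendsto (tailBound K d) atTop (𝓝 0) := by
  have h : Tendsto (fun M : ℕ => ∑' v : HeightOneSpectrum (𝓞 K),
      if M < below v then localDensity d v else 0) atTop
      (𝓝 (∑' _ : HeightOneSpectrum (𝓞 K), (0 : ℝ))) := by
    refine tendsto_tsum_of_dominated_convergence (summable_localDensity K hd) (fun v => ?_)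
      (Eventually.of_forall fun M v => ?_)
    · refine tendsto_const_nhds.congr' ?_
      filter_upwards [eventually_ge_atTop (below v)] with M hM
      rw [if_neg (by omega)]
    · have := localDensity_pos (d := d) v
      split_ifs <;> simp [abs_of_pos, this, this.le]
  have := h.const_mul (2 ^ (Module.finrank ℚ K * (d + 1)) : ℝ)
  rw [tsum_zero, mul_zero] at this
  exact this

/-- Split at `p = H^(1/2)`. Below it a union bound over single primes applies (the case `n = 1`);
above it the large-prime estimate takes over as `H → ∞`. -/
theorem boxRatio_tail_le (hd : 3 ≤ d) (M : ℕ) {H : ℕ} (hH : 1 ≤ H) :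
    boxRatio E {a | ∃ v, M < below v ∧ (shiftedEisensteinSystem K d).MemFinite v a} H ≤
      tailBound K d M + boxRatio E {a | ∃ v, (H : ℝ) ^ (1 / 2 : ℝ) < below v ∧
        (shiftedEisensteinSystem K d).MemFinite v a} H := by
  set V := (finite_below_le K ((H : ℝ) ^ (1 / 2 : ℝ))).toFinset.filter fun v => M < below v with hV
  have hmem (v) : v ∈ V ↔ (below v : ℝ) ≤ (H : ℝ) ^ (1 / 2 : ℝ) ∧ M < below v := by
    rw [hV, Finset.mem_filter, Set.Finite.mem_toFinset]; rfl
  let T (v : HeightOneSpectrum (𝓞 K)) : Set (Fin (d + 1) → 𝓞 K) :=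
    {a | ∀ w ∈ ({v} : Finset _), (shiftedEisensteinSystem K d).MemFinite w a}
  have hT : boxRatio E {a | ∃ v ∈ V, a ∈ T v} H ≤ tailBound K d M := by
    refine (boxRatio_biUnion_le E V T H).trans ?_
    calc _ ≤ ∑ v ∈ V, 2 ^ (Module.finrank ℚ K * (d + 1)) *
          (if M < below v then localDensity d v else 0) := by
          refine Finset.sum_le_sum fun v hv => ?_
          rw [if_pos ((hmem v).1 hv).2, ← Finset.prod_singleton (localDensity d) v]
          refine boxRatio_forall_memFinite_le E (by omega) le_rfl hH (by simp) fun w hw => ?_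
          rw [Finset.mem_singleton.1 hw]
          simpa using ((hmem v).1 hv).1
      _ ≤ _ := by
          rw [← Finset.mul_sum, tailBound]
          refine mul_le_mul_of_nonneg_left ((summable_ite_localDensity hd fun v => M < below v).sum_le_tsum V
            fun v _ => ?_) (by positivity)
          have := localDensity_pos (d := d) v
          split_ifs <;> linarith
  refine le_trans (boxRatio_mono E ?_ H) ((boxRatio_union_le E {a | ∃ v ∈ V, a ∈ T v} _ H).trans
    (add_le_add hT le_rfl))
  rintro a ⟨v, hv, hva⟩
  rcases le_or_gt (below v : ℝ) ((H : ℝ) ^ (1 / 2 : ℝ)) with h | h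
  · exact Or.inl ⟨v, (hmem v).2 ⟨h, hv⟩, fun w hw => Finset.mem_singleton.1 hw ▸ hva⟩
  · exact Or.inr ⟨v, h, hva⟩

theorem tailCondition (hd : 3 ≤ d) : (shiftedEisensteinSystem K d).TailCondition E := by
  refine squeeze_zero (fun M => ?_) (fun M => ?_) (tendsto_tailBound K hd)
  · refine le_limsup_of_frequently_le (Eventually.of_forall fun H => boxRatio_nonneg E _ H).frequently
      ⟨1, ?_⟩
    simpa using ⟨0, fun H _ => boxRatio_le_one E _ H⟩
  · have hlim := (tendsto_boxRatio_memFinite_large E hd (β := 1 / 2) (by norm_num)).const_add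
      (tailBound K d M)
    rw [add_zero] at hlim
    rw [upperDensity, ← hlim.limsup_eq]
    refine limsup_le_limsup ?_ ?_ hlim.isBoundedUnder_le
    · filter_upwards [eventually_ge_atTop 1] with H hH
      exact boxRatio_tail_le E hd M hH
    · exact isCoboundedUnder_le_of_le (x := 0) _ fun H => boxRatio_nonneg E _ H

theorem places_eq (a : Fin (d + 1) → 𝓞 K) : (shiftedEisensteinSystem K d).places a =
    some '' {v | (shiftedEisensteinSystem K d).MemFinite v a} := by
  ext η
  rcases η with _ | v
  · simp [LocalSystem.places, LocalSystem.MemInfinite, shiftedEisensteinSystem]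
  · simp [LocalSystem.places]

theorem exceptional_eq_empty (hd : 2 ≤ d) : (shiftedEisensteinSystem K d).exceptional = ∅ := by
  refine Set.eq_empty_iff_forall_notMem.2 fun a ha => ha ?_
  rw [places_eq]
  exact (finite_setOf_memFinite hd a).image _

theorem boxI_eq (hd : 2 ≤ d) (H : ℕ) :
    (shiftedEisensteinSystem K d).boxI E H = box E (d + 1) H := by
  simp [LocalSystem.boxI, exceptional_eq_empty hd]

theorem mem_shiftedEisenstein_iff (hd : 2 ≤ d) (a : Fin (d + 1) → 𝓞 K) :
    a ∈ shiftedEisenstein K d ↔ ∃ v, (shiftedEisensteinSystem K d).MemFinite v a := by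
  simp only [memFinite_iff _ hd]
  rfl

theorem correspondsTo (hd : 3 ≤ d) :
    (shiftedEisensteinSystem K d).CorrespondsTo E (shiftedEisenstein K d) := by
  refine ⟨tailCondition E hd, ?_⟩
  ext a
  rw [Set.mem_compl_iff, mem_shiftedEisenstein_iff (by omega)]
  change _ ↔ _ = ∅
  rw [places_eq, Set.image_eq_empty, Set.eq_empty_iff_forall_notMem, not_exists]
  rfl

theorem momentConditions (hd : 3 ≤ d) {n : ℕ} (hn : 1 ≤ n) :
    (shiftedEisensteinSystem K d).MomentConditions E n where
  frontier_finite v := by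
    rw [(isClopen_finite v d).frontier_eq]
    let : MeasurableSpace (Fin (d + 1) → v.adicCompletionIntegers K) := borel _
    exact MeasureTheory.measure_empty
  frontier_infinite := by simp [shiftedEisensteinSystem]
  cone := by simp [shiftedEisensteinSystem]
  tail := tailCondition E hd
  bounds := by
    have hnR : (0 : ℝ) < n := by exact_mod_cast hn
    have hβ : (0 : ℝ) < 1 / (2 * n : ℝ) := by positivity
    obtain ⟨c, hc⟩ := exists_card_le_of_memFinite E (d := d) (by omega) hβ
    -- The cutoff is `H^(1/(2n))`; `c + 1` makes the bound strict. The weight of 𝔭 is `s_𝔭` times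
    -- the constant from the uniform count.
    refine ⟨1 / (2 * n : ℝ), 1, c + 1, hβ.le, ?_, fun v => 2 ^ (Module.finrank ℚ K * (d + 1)) *
      localDensity d v, (summable_localDensity K hd).mul_left _, ?_⟩
    · intro H hH a ha
      rw [boxI_eq E (by omega)] at ha
      have hfin : {v | ((1 : ℤ) : ℝ) * (H : ℝ) ^ (1 / (2 * n : ℝ)) < below v ∧
          (shiftedEisensteinSystem K d).MemFinite v a}.Finite :=
        (finite_setOf_memFinite (by omega) a).subset fun v hv => hv.2
      refine ⟨hfin, ?_⟩
      rw [Set.ncard_eq_toFinset_card _ hfin, Int.lt_add_one_iff, Nat.cast_le]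
      refine hc H hH a ha _ fun v hv => ?_
      simpa using (Set.Finite.mem_toFinset _).1 hv
    · intro H hH S hS hSn hSb
      have h := boxRatio_forall_memFinite_le E (d := d) (by omega) hn hH hSn
        fun v hv => by simpa using hSb v hv
      rw [boxRatio_eq E (T := {a | ∀ v ∈ S, (shiftedEisensteinSystem K d).MemFinite v a})
        (fun a => ∀ v ∈ S, (shiftedEisensteinSystem K d).MemFinite v a)
        (fun _ => Iff.rfl), div_le_iff₀ (boxSize_pos _ hH)] at h
      rw [boxI_eq E (by omega), mul_comm, Finset.prod_mul_distrib, Finset.prod_const]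
      refine h.trans (mul_le_mul_of_nonneg_right (mul_le_mul_of_nonneg_right ?_ ?_)
        (boxSize_nonneg _ _))
      -- The count carries the constant once, the product of weights carries it once per prime; this
      -- is enough because `S` is nonempty.
      · exact le_self_pow₀ (one_le_pow₀ one_le_two) (Finset.card_ne_zero.2 hS)
      · exact Finset.prod_nonneg fun v _ => (localDensity_pos v).le

/-- Avoiding all primes is approximated by avoiding those above `p ≤ M`, with an error at most the
tail. First `M` is fixed, then `H → ∞`. The four quarters of `ε` go to the partial product, the tail
bound, the finite sieve and the large primes. -/
theorem hasDensity_compl (hd : 3 ≤ d) : HasDensity E (shiftedEisenstein K d)ᶜ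
    (∏' v : HeightOneSpectrum (𝓞 K), (1 - localDensity d v)) := by
  have hL := tendsto_boxRatio_memFinite_large E hd (β := 1 / 2) (by norm_num)
  let S (M : ℕ) : Finset (HeightOneSpectrum (𝓞 K)) := (finite_below_le K M).toFinset
  have hSmem (M : ℕ) (v) : v ∈ S M ↔ below v ≤ M := by
    rw [Set.Finite.mem_toFinset]
    change (below v : ℝ) ≤ M ↔ _
    exact Nat.cast_le
  have hS : Tendsto S atTop atTop :=
    tendsto_atTop_finset_of_monotone
      (fun M M' h v hv => (hSmem _ _).2 (((hSmem _ _).1 hv).trans h))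
      fun v => ⟨below v, (hSmem _ _).2 le_rfl⟩
  have hP := (multipliable_one_sub_localDensity K hd).hasProd.comp hS
  rw [HasDensity, Metric.tendsto_atTop']
  intro ε hε
  have h1 := (Metric.tendsto_nhds.1 hP (ε / 4) (by positivity)).and
    (Metric.tendsto_nhds.1 (tendsto_tailBound K hd) (ε / 4) (by positivity))
  obtain ⟨M, hM1, hM2⟩ := h1.exists
  have hN := tendsto_boxRatio_forall_not_memFinite E (d := d) (by omega) (S M)
  have h2 := ((Metric.tendsto_nhds.1 hN (ε / 4) (by positivity)).and
    (Metric.tendsto_nhds.1 hL (ε / 4) (by positivity))).and (eventually_ge_atTop 1)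
  obtain ⟨H₀, hH₀⟩ := eventually_atTop.1 h2
  refine ⟨H₀, fun H hH => ?_⟩
  obtain ⟨⟨hH1, hH2⟩, hH3⟩ := hH₀ H hH.le
  have hle : boxRatio E (shiftedEisenstein K d)ᶜ H ≤
      boxRatio E {a | ∀ v ∈ S M, ¬ (shiftedEisensteinSystem K d).MemFinite v a} H := by
    refine boxRatio_mono E ?_ H
    intro a ha v _ hv
    exact ha ((mem_shiftedEisenstein_iff (by omega) a).2 ⟨v, hv⟩)
  have hge : boxRatio E {a | ∀ v ∈ S M, ¬ (shiftedEisensteinSystem K d).MemFinite v a} H ≤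
      boxRatio E (shiftedEisenstein K d)ᶜ H +
        boxRatio E {a | ∃ v, M < below v ∧ (shiftedEisensteinSystem K d).MemFinite v a} H := by
    refine (boxRatio_mono E (fun a ha => ?_) H).trans (boxRatio_union_le E _ _ H)
    by_cases h : a ∈ shiftedEisenstein K d
    · obtain ⟨v, hv⟩ := (mem_shiftedEisenstein_iff (by omega) a).1 h
      exact Or.inr ⟨v, not_le.1 fun hvM => ha v ((hSmem _ _).2 hvM) hv, hv⟩
    · exact Or.inl h
  have ht := boxRatio_tail_le E hd M hH3
  simp only [Function.comp, Real.dist_eq, sub_zero] at hM1 hM2 hH1 hH2 ⊢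
  rw [abs_lt] at *
  constructor <;> linarith

theorem hasDensity_shiftedEisenstein (hd : 3 ≤ d) : HasDensity E (shiftedEisenstein K d)
    (1 - ∏' v : HeightOneSpectrum (𝓞 K), (1 - localDensity d v)) := by
  refine ((hasDensity_compl E hd).const_sub 1).congr' ?_
  filter_upwards [eventually_ge_atTop 1] with H hH
  rw [boxRatio_compl E _ hH, sub_sub_cancel]

end Tail

/-! ### First and second moments -/

section Moments

variable {K : Type*} [Field K] [NumberField K] (E : IntegralBasis K) {d : ℕ}

/-- The indicator function of the vectors lying in the local sets of all primes in `S`. -/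
noncomputable def memIndicator (d : ℕ) (S : Finset (HeightOneSpectrum (𝓞 K)))
    (a : Fin (d + 1) → 𝓞 K) : ℝ :=
  if ∀ v ∈ S, (shiftedEisensteinSystem K d).MemFinite v a then 1 else 0

theorem memIndicator_mul (v w : HeightOneSpectrum (𝓞 K)) (a : Fin (d + 1) → 𝓞 K) :
    memIndicator d {v} a * memIndicator d {w} a = memIndicator d {v, w} a := by
  by_cases hv : (shiftedEisensteinSystem K d).MemFinite v a <;>
    by_cases hw : (shiftedEisensteinSystem K d).MemFinite w a <;> simp [memIndicator, hv, hw]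

theorem sum_memIndicator (S : Finset (HeightOneSpectrum (𝓞 K))) (H : ℕ) :
    (∑ a ∈ box E (d + 1) H, memIndicator d S a) / boxSize K (d + 1) H =
      boxRatio E {a | ∀ v ∈ S, (shiftedEisensteinSystem K d).MemFinite v a} H := by
  rw [boxRatio_eq E (T := {a | ∀ v ∈ S, (shiftedEisensteinSystem K d).MemFinite v a})
    (fun a => ∀ v ∈ S, (shiftedEisensteinSystem K d).MemFinite v a) (fun _ => Iff.rfl)]
  simp [memIndicator]

/-- Interchange of limit and sum by dominated convergence. The cutoff supplies the uniform majorant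
and, for each fixed `i`, is eventually inactive. The family `S` will run over singletons and pairs.
-/
theorem tendsto_tsum_boxRatio (hd : 3 ≤ d) {n : ℕ} (hn : 1 ≤ n) {ι : Type*}
    (S : ι → Finset (HeightOneSpectrum (𝓞 K))) (hS : ∀ i, (S i).card ≤ n)
    (hsum : Summable fun i => ∏ v ∈ S i, localDensity d v) :
    Tendsto (fun H : ℕ => ∑' i, if ∀ v ∈ S i, (below v : ℝ) ≤ (H : ℝ) ^ (1 / (2 * n : ℝ)) then
        boxRatio E {a | ∀ v ∈ S i, (shiftedEisensteinSystem K d).MemFinite v a} H else 0) atTop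
      (𝓝 (∑' i, ∏ v ∈ S i, localDensity d v)) := by
  have hnR : (0 : ℝ) < n := by exact_mod_cast hn
  have hpow : Tendsto (fun H : ℕ => (H : ℝ) ^ (1 / (2 * n : ℝ))) atTop atTop :=
    (tendsto_rpow_atTop (by positivity)).comp tendsto_natCast_atTop_atTop
  refine tendsto_tsum_of_dominated_convergence
    (hsum.mul_left (2 ^ (Module.finrank ℚ K * (d + 1)) : ℝ)) (fun i => ?_) ?_
  · refine (tendsto_boxRatio_forall_memFinite E (by omega) (S i)).congr' ?_
    have : ∀ᶠ H : ℕ in atTop, ∀ v ∈ S i, (below v : ℝ) ≤ (H : ℝ) ^ (1 / (2 * n : ℝ)) :=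
      (Finset.eventually_all (S i)).2 fun v _ => hpow.eventually_ge_atTop _
    filter_upwards [this] with H hH
    rw [if_pos hH]
  · filter_upwards [eventually_ge_atTop 1] with H hH i
    have h0 : 0 ≤ ∏ v ∈ S i, localDensity d v :=
      Finset.prod_nonneg fun v _ => (localDensity_pos v).le
    split_ifs with h
    · rw [Real.norm_eq_abs, abs_of_nonneg (boxRatio_nonneg E _ H)]
      exact boxRatio_forall_memFinite_le E (by omega) hn hH (hS i) h
    · rw [norm_zero]
      positivity

/-- The primes above rational primes up to `x`. -/
noncomputable def primesUpTo (K : Type*) [Field K] [NumberField K] (x : ℝ) :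
    Finset (HeightOneSpectrum (𝓞 K)) :=
  (finite_below_le K x).toFinset

theorem mem_primesUpTo {x : ℝ} {v : HeightOneSpectrum (𝓞 K)} :
    v ∈ primesUpTo K x ↔ (below v : ℝ) ≤ x := by
  rw [primesUpTo, Set.Finite.mem_toFinset]
  rfl

/-- The number of primes above rational primes up to `x` in whose local set `a` lies. -/
noncomputable def smallCount (d : ℕ) (x : ℝ) (a : Fin (d + 1) → 𝓞 K) : ℝ :=
  ∑ v ∈ primesUpTo K x, memIndicator d {v} a

theorem smallCount_nonneg (x : ℝ) (a : Fin (d + 1) → 𝓞 K) : 0 ≤ smallCount d x a :=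
  Finset.sum_nonneg fun v _ => by rw [memIndicator]; split_ifs <;> norm_num

/-- The exponent `1/4` is `1/(2n)` for `n = 2`, so that both moments share one cutoff. -/
theorem tendsto_smallCount (hd : 3 ≤ d) :
    Tendsto (fun H : ℕ => (∑ a ∈ box E (d + 1) H, smallCount d ((H : ℝ) ^ (1 / (4 : ℝ))) a) /
      boxSize K (d + 1) H) atTop (𝓝 (∑' v : HeightOneSpectrum (𝓞 K), localDensity d v)) := by
  have h := tendsto_tsum_boxRatio E hd (n := 2) (by norm_num)
    (fun v : HeightOneSpectrum (𝓞 K) => {v}) (by simp)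
    (by simpa using summable_localDensity K hd)
  simp only [Finset.prod_singleton] at h
  refine h.congr fun H => ?_
  rw [tsum_eq_sum (s := primesUpTo K ((H : ℝ) ^ (1 / (4 : ℝ))))]
  · simp only [smallCount]
    rw [Finset.sum_comm, Finset.sum_div]
    refine Finset.sum_congr rfl fun v hv => ?_
    rw [if_pos, sum_memIndicator]
    intro w hw
    rw [Finset.mem_singleton.1 hw]
    have := mem_primesUpTo.1 hv
    norm_num at this ⊢
    exact this
  · intro v hv
    rw [mem_primesUpTo] at hv
    rw [if_neg]
    norm_num at hv ⊢
    exact hv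

/-- On the diagonal the set `{v, v}` is a singleton and contributes `s_v` instead of `s_v²`. The sum
is therefore `μ²` corrected by `∑ (s_v - s_v²)`. -/
theorem hasSum_prod_pair (hd : 3 ≤ d) :
    HasSum (fun p : HeightOneSpectrum (𝓞 K) × HeightOneSpectrum (𝓞 K) =>
      ∏ v ∈ ({p.1, p.2} : Finset _), localDensity d v)
      ((∑' v : HeightOneSpectrum (𝓞 K), localDensity d v) ^ 2 -
        ∑' v : HeightOneSpectrum (𝓞 K), localDensity d v ^ 2 +
        ∑' v : HeightOneSpectrum (𝓞 K), localDensity d v) := by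
  have hs := summable_localDensity K hd
  have hs2 := summable_localDensity_sq K hd
  have h1 : HasSum (fun p : HeightOneSpectrum (𝓞 K) × HeightOneSpectrum (𝓞 K) =>
      localDensity d p.1 * localDensity d p.2)
      ((∑' v : HeightOneSpectrum (𝓞 K), localDensity d v) *
        ∑' v : HeightOneSpectrum (𝓞 K), localDensity d v) :=
    hs.hasSum.mul hs.hasSum (hs.mul_of_nonneg hs (fun v => (localDensity_pos v).le)
      fun v => (localDensity_pos v).le)
  have hinj : Function.Injective fun v : HeightOneSpectrum (𝓞 K) => (v, v) :=
    fun v w h => (Prod.ext_iff.1 h).1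
  have h2 : HasSum (fun p : HeightOneSpectrum (𝓞 K) × HeightOneSpectrum (𝓞 K) =>
      if p.1 = p.2 then localDensity d p.1 - localDensity d p.1 ^ 2 else 0)
      ((∑' v : HeightOneSpectrum (𝓞 K), localDensity d v) -
        ∑' v : HeightOneSpectrum (𝓞 K), localDensity d v ^ 2) := by
    rw [← hinj.hasSum_iff]
    · simpa [Function.comp_def] using hs.hasSum.sub hs2.hasSum
    · rintro ⟨v, w⟩ hvw
      rw [if_neg]
      intro h
      exact hvw ⟨v, Prod.ext rfl h⟩
  convert h1.add h2 using 1
  · funext p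
    split_ifs with h
    · rw [h]; simp; ring
    · rw [Finset.prod_pair h, add_zero]
  · ring

theorem tendsto_smallCount_sq (hd : 3 ≤ d) :
    Tendsto (fun H : ℕ => (∑ a ∈ box E (d + 1) H, smallCount d ((H : ℝ) ^ (1 / (4 : ℝ))) a ^ 2) /
      boxSize K (d + 1) H) atTop (𝓝 ((∑' v : HeightOneSpectrum (𝓞 K), localDensity d v) ^ 2 -
        ∑' v : HeightOneSpectrum (𝓞 K), localDensity d v ^ 2 +
        ∑' v : HeightOneSpectrum (𝓞 K), localDensity d v)) := by
  have hp := hasSum_prod_pair (K := K) hd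
  have h := tendsto_tsum_boxRatio E hd (n := 2) (by norm_num)
    (fun p : HeightOneSpectrum (𝓞 K) × HeightOneSpectrum (𝓞 K) => {p.1, p.2})
    (fun p => Finset.card_le_two) hp.summable
  rw [hp.tsum_eq] at h
  refine h.congr fun H => ?_
  rw [tsum_eq_sum (s := primesUpTo K ((H : ℝ) ^ (1 / (4 : ℝ))) ×ˢ
    primesUpTo K ((H : ℝ) ^ (1 / (4 : ℝ))))]
  · have e (a : Fin (d + 1) → 𝓞 K) : smallCount d ((H : ℝ) ^ (1 / (4 : ℝ))) a ^ 2 =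
        ∑ p ∈ primesUpTo K ((H : ℝ) ^ (1 / (4 : ℝ))) ×ˢ primesUpTo K ((H : ℝ) ^ (1 / (4 : ℝ))),
          memIndicator d {p.1, p.2} a := by
      simp only [← memIndicator_mul]
      rw [pow_two, smallCount, Finset.sum_mul_sum, ← Finset.sum_product']
    simp only [e]
    rw [Finset.sum_comm, Finset.sum_div]
    refine Finset.sum_congr rfl fun p hp => ?_
    rw [if_pos, sum_memIndicator]
    have h1 := mem_primesUpTo.1 (Finset.mem_product.1 hp).1
    have h2 := mem_primesUpTo.1 (Finset.mem_product.1 hp).2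
    norm_num at h1 h2 ⊢
    exact ⟨h1, h2⟩
  · intro p hp
    rw [Finset.mem_product, mem_primesUpTo, mem_primesUpTo] at hp
    rw [if_neg]
    norm_num at hp ⊢
    exact hp

/-- The number of primes in whose local set `a` lies is approximated by `smallCount`. -/
theorem exists_ncard_places_eq (hd : 2 ≤ d) {β : ℝ} (hβ : 0 < β) :
    ∃ c : ℝ, 0 ≤ c ∧ ∀ H : ℕ, 1 ≤ H → ∀ a ∈ box E (d + 1) H, ∃ l : ℝ, 0 ≤ l ∧ l ≤ c ∧
      (((shiftedEisensteinSystem K d).places a).ncard : ℝ) = smallCount d ((H : ℝ) ^ β) a + l ∧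
      (a ∉ {a | ∃ v, (H : ℝ) ^ β < below v ∧ (shiftedEisensteinSystem K d).MemFinite v a} →
        l = 0) := by
  obtain ⟨c, hc⟩ := exists_card_le_of_memFinite E hd hβ
  refine ⟨c, Nat.cast_nonneg _, fun H hH a ha => ?_⟩
  have hfin := finite_setOf_memFinite hd a
  have hmem (v) : v ∈ hfin.toFinset ↔ (shiftedEisensteinSystem K d).MemFinite v a := by
    rw [Set.Finite.mem_toFinset]; rfl
  refine ⟨(hfin.toFinset.filter fun v => ¬ (below v : ℝ) ≤ (H : ℝ) ^ β).card, Nat.cast_nonneg _,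
    ?_, ?_, fun h => ?_⟩
  · rw [Nat.cast_le]
    refine hc H hH a ha _ fun v hv => ?_
    rw [Finset.mem_filter, hmem, not_le] at hv
    exact hv.symm
  · have e : smallCount d ((H : ℝ) ^ β) a =
        (hfin.toFinset.filter fun v => (below v : ℝ) ≤ (H : ℝ) ^ β).card := by
      have e1 : (hfin.toFinset.filter fun v => (below v : ℝ) ≤ (H : ℝ) ^ β) =
          (primesUpTo K ((H : ℝ) ^ β)).filter fun v =>
            (shiftedEisensteinSystem K d).MemFinite v a := by
        ext v
        rw [Finset.mem_filter, Finset.mem_filter, hmem, mem_primesUpTo, and_comm]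
      rw [e1]
      simp [smallCount, memIndicator]
    rw [e, places_eq, Set.ncard_image_of_injective _ (Option.some_injective _),
      Set.ncard_eq_toFinset_card _ hfin]
    exact_mod_cast (Finset.card_filter_add_card_filter_not _).symm
  · rw [Nat.cast_eq_zero, Finset.card_eq_zero, Finset.filter_eq_empty_iff]
    intro v hv hlt
    exact h ⟨v, not_le.1 hlt, (hmem v).1 hv⟩

theorem exists_ncard_places_le (hd : 2 ≤ d) {β : ℝ} (hβ : 0 < β) :
    ∃ c : ℝ, 0 ≤ c ∧ ∀ H : ℕ, 1 ≤ H → ∀ a ∈ box E (d + 1) H,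
      smallCount d ((H : ℝ) ^ β) a ≤ (((shiftedEisensteinSystem K d).places a).ncard : ℝ) ∧
      (((shiftedEisensteinSystem K d).places a).ncard : ℝ) ≤ smallCount d ((H : ℝ) ^ β) a +
        c * Set.indicator {a | ∃ v, (H : ℝ) ^ β < below v ∧
          (shiftedEisensteinSystem K d).MemFinite v a} 1 a := by
  obtain ⟨c, hc, h⟩ := exists_ncard_places_eq E hd hβ
  refine ⟨c, hc, fun H hH a ha => ?_⟩
  obtain ⟨l, hl0, hlc, hX, hl⟩ := h H hH a ha
  rw [hX]
  refine ⟨by linarith, ?_⟩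
  by_cases hT : a ∈ {a | ∃ v, (H : ℝ) ^ β < below v ∧ (shiftedEisensteinSystem K d).MemFinite v a}
  · rw [Set.indicator_of_mem hT]
    simpa using hlc
  · rw [hl hT, Set.indicator_of_notMem hT]
    simp

theorem sum_indicator_div (T : Set (Fin (d + 1) → 𝓞 K)) (H : ℕ) :
    (∑ a ∈ box E (d + 1) H, Set.indicator T (1 : (Fin (d + 1) → 𝓞 K) → ℝ) a) / boxSize K (d + 1) H =
      boxRatio E T H := by
  simp [boxRatio, Set.indicator_apply]

theorem hasMoment_one (hd : 3 ≤ d) : (shiftedEisensteinSystem K d).HasMoment E 1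
    (∑' v : HeightOneSpectrum (𝓞 K), localDensity d v) := by
  obtain ⟨c, hc, h⟩ := exists_ncard_places_le E (d := d) (by omega)
    (β := 1 / (4 : ℝ)) (by norm_num)
  have hA := tendsto_smallCount E hd
  have hT := (tendsto_boxRatio_memFinite_large E hd (β := 1 / (4 : ℝ)) (by norm_num)).const_mul c
  have hAT := hA.add hT
  rw [mul_zero, add_zero] at hAT
  simp only [LocalSystem.HasMoment, boxI_eq E (show 2 ≤ d by omega), pow_one]
  refine tendsto_of_tendsto_of_tendsto_of_le_of_le' hA hAT ?_ ?_
  · filter_upwards [eventually_ge_atTop 1] with H hH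
    exact div_le_div_of_nonneg_right (Finset.sum_le_sum fun a ha => (h H hH a ha).1)
      (boxSize_nonneg _ _)
  · filter_upwards [eventually_ge_atTop 1] with H hH
    rw [← sum_indicator_div, ← mul_div_assoc, ← add_div, Finset.mul_sum, ← Finset.sum_add_distrib]
    exact div_le_div_of_nonneg_right (Finset.sum_le_sum fun a ha => (h H hH a ha).2)
      (boxSize_nonneg _ _)

/-- Squaring `X ≤ A + c · 1_T`, with `A` the small count and `T` the large-prime set, leaves the
cross term `A · 1_T`. Cauchy–Schwarz bounds its mean by the root of (mean of `A²`) times (proportion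
of `T`), which tends to zero. -/
theorem hasMoment_two (hd : 3 ≤ d) : (shiftedEisensteinSystem K d).HasMoment E 2
    ((∑' v : HeightOneSpectrum (𝓞 K), localDensity d v) ^ 2 -
        ∑' v : HeightOneSpectrum (𝓞 K), localDensity d v ^ 2 +
        ∑' v : HeightOneSpectrum (𝓞 K), localDensity d v) := by
  obtain ⟨c, hc, h⟩ := exists_ncard_places_le E (d := d) (by omega)
    (β := 1 / (4 : ℝ)) (by norm_num)
  have hA := tendsto_smallCount_sq E hd
  have hT := tendsto_boxRatio_memFinite_large E hd (β := 1 / (4 : ℝ)) (by norm_num)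
  have hcross := (hA.mul hT).sqrt
  have hlim := hA.add ((hcross.const_mul (2 * c)).add (hT.const_mul (c ^ 2)))
  simp only [mul_zero, Real.sqrt_zero, add_zero] at hlim
  simp only [LocalSystem.HasMoment, boxI_eq E (show 2 ≤ d by omega)]
  refine tendsto_of_tendsto_of_tendsto_of_le_of_le' hA hlim ?_ ?_
  · filter_upwards [eventually_ge_atTop 1] with H hH
    refine div_le_div_of_nonneg_right (Finset.sum_le_sum fun a ha => ?_) (boxSize_nonneg _ _)
    exact pow_le_pow_left₀ (smallCount_nonneg _ _) (h H hH a ha).1 2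
  · filter_upwards [eventually_ge_atTop 1] with H hH
    set T : Set (Fin (d + 1) → 𝓞 K) := {a | ∃ v, (H : ℝ) ^ (1 / (4 : ℝ)) < below v ∧
      (shiftedEisensteinSystem K d).MemFinite v a}
    set A : (Fin (d + 1) → 𝓞 K) → ℝ := smallCount d ((H : ℝ) ^ (1 / (4 : ℝ)))
    have hN := boxSize_pos (K := K) (d + 1) hH
    have hsq (a) : Set.indicator T (1 : (Fin (d + 1) → 𝓞 K) → ℝ) a ^ 2 = Set.indicator T 1 a := by
      by_cases ha : a ∈ T <;> simp [ha]
    have hCS : (∑ a ∈ box E (d + 1) H, A a * Set.indicator T 1 a) / boxSize K (d + 1) H ≤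
        √((∑ a ∈ box E (d + 1) H, A a ^ 2) / boxSize K (d + 1) H * boxRatio E T H) := by
      refine Real.le_sqrt_of_sq_le ?_
      rw [← sum_indicator_div, div_mul_div_comm, div_pow, pow_two (boxSize K (d + 1) H)]
      refine div_le_div_of_nonneg_right ?_ (by positivity)
      have := Finset.sum_mul_sq_le_sq_mul_sq (box E (d + 1) H) A (Set.indicator T 1)
      simpa only [hsq] using this
    have hpt (a) (ha : a ∈ box E (d + 1) H) :
        (((shiftedEisensteinSystem K d).places a).ncard : ℝ) ^ 2 ≤
          A a ^ 2 + (2 * c * (A a * Set.indicator T 1 a) + c ^ 2 * Set.indicator T 1 a) := by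
      refine (pow_le_pow_left₀ (Nat.cast_nonneg _) (h H hH a ha).2 2).trans (le_of_eq ?_)
      rw [← hsq a]
      by_cases ha : a ∈ T
      · simp only [Set.indicator_of_mem ha, Pi.one_apply, A]; ring
      · simp only [Set.indicator_of_notMem ha, A]; ring
    calc _ ≤ (∑ a ∈ box E (d + 1) H, (A a ^ 2 + (2 * c * (A a * Set.indicator T 1 a) +
          c ^ 2 * Set.indicator T 1 a))) / boxSize K (d + 1) H :=
          div_le_div_of_nonneg_right (Finset.sum_le_sum hpt) hN.le
      _ = (∑ a ∈ box E (d + 1) H, A a ^ 2) / boxSize K (d + 1) H +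
          (2 * c * ((∑ a ∈ box E (d + 1) H, A a * Set.indicator T 1 a) / boxSize K (d + 1) H) +
            c ^ 2 * boxRatio E T H) := by
          rw [← sum_indicator_div, Finset.sum_add_distrib, Finset.sum_add_distrib,
            ← Finset.mul_sum, ← Finset.mul_sum]
          ring
      _ ≤ _ := by
          have := mul_le_mul_of_nonneg_left hCS (show 0 ≤ 2 * c by positivity)
          linarith

end Moments

/-! ### Restriction to the shifted Eisenstein polynomials -/

section Restricted

variable {K : Type*} [Field K] [NumberField K] (E : IntegralBasis K) {d : ℕ}

/-- The count of places is zero outside the set, so restricting a positive moment changes only the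
normalization. -/
theorem sum_filter_shiftedEisenstein (hd : 2 ≤ d) {n : ℕ} (hn : n ≠ 0)
    (s : Finset (Fin (d + 1) → 𝓞 K)) :
    ∑ a ∈ s.filter (· ∈ shiftedEisenstein K d),
      (((shiftedEisensteinSystem K d).places a).ncard : ℝ) ^ n =
    ∑ a ∈ s, (((shiftedEisensteinSystem K d).places a).ncard : ℝ) ^ n := by
  refine Finset.sum_filter_of_ne fun a _ h => ?_
  by_contra hT
  have : (shiftedEisensteinSystem K d).places a = ∅ := by
    rw [places_eq, Set.image_eq_empty, Set.eq_empty_iff_forall_notMem]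
    exact fun v hv => hT ((mem_shiftedEisenstein_iff hd a).2 ⟨v, hv⟩)
  rw [this] at h
  simp [hn] at h

theorem hasRestrictedMoment_one (hd : 3 ≤ d) {ρ μ : ℝ} (hρ : ρ ≠ 0)
    (h0 : HasDensity E (shiftedEisenstein K d) ρ)
    (h1 : (shiftedEisensteinSystem K d).HasMoment E 1 μ) :
    (shiftedEisensteinSystem K d).HasRestrictedMoment E (shiftedEisenstein K d) 1 (ρ⁻¹ * μ) := by
  rw [mul_comm, ← div_eq_mul_inv]
  refine (Tendsto.div h1 h0 hρ).congr' ?_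
  filter_upwards [eventually_ge_atTop 1] with H hH
  simp only [boxI_eq E (show 2 ≤ d by omega), Pi.div_apply, boxRatio]
  rw [sum_filter_shiftedEisenstein (by omega) one_ne_zero, div_div_div_cancel_right₀ (boxSize_pos _ hH).ne']

/-- Expand the square: the terms are the two moments and `t²` times the number of restricted points,
all divided by the density. -/
theorem hasRestrictedVariance (hd : 3 ≤ d) {ρ μ m₂ : ℝ} (hρ : ρ ≠ 0)
    (h0 : HasDensity E (shiftedEisenstein K d) ρ)
    (h1 : (shiftedEisensteinSystem K d).HasMoment E 1 μ)
    (h2 : (shiftedEisensteinSystem K d).HasMoment E 2 m₂) :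
    (shiftedEisensteinSystem K d).HasRestrictedVariance E (shiftedEisenstein K d)
      (1 / ρ * m₂ - 2 * (ρ⁻¹ * μ) / ρ * μ + (ρ⁻¹ * μ) ^ 2) := by
  refine ⟨ρ⁻¹ * μ, hasRestrictedMoment_one E hd hρ h0 h1, ?_⟩
  set t := ρ⁻¹ * μ
  have h := Tendsto.div ((Tendsto.sub h2 (Tendsto.const_mul (2 * t) h1)).add
    (Tendsto.const_mul (t ^ 2) h0)) h0 hρ
  have e : (m₂ - 2 * t * μ + t ^ 2 * ρ) / ρ = 1 / ρ * m₂ - 2 * t / ρ * μ + t ^ 2 := by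
    field_simp
  rw [e] at h
  refine h.congr' ?_
  filter_upwards [eventually_ge_atTop 1] with H hH
  have hN := (boxSize_pos (K := K) (d + 1) hH).ne'
  have hsum : ∑ a ∈ (box E (d + 1) H).filter (· ∈ shiftedEisenstein K d),
      ((((shiftedEisensteinSystem K d).places a).ncard : ℝ) - t) ^ 2 =
      ∑ a ∈ box E (d + 1) H, (((shiftedEisensteinSystem K d).places a).ncard : ℝ) ^ 2 -
        2 * t * ∑ a ∈ box E (d + 1) H, (((shiftedEisensteinSystem K d).places a).ncard : ℝ) ^ 1 +
        t ^ 2 * ((box E (d + 1) H).filter (· ∈ shiftedEisenstein K d)).card := by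
    rw [← sum_filter_shiftedEisenstein (by omega) one_ne_zero,
      ← sum_filter_shiftedEisenstein (by omega) two_ne_zero, Finset.mul_sum,
      ← Finset.sum_sub_distrib, mul_comm (t ^ 2), ← nsmul_eq_mul, ← Finset.sum_const,
      ← Finset.sum_add_distrib]
    exact Finset.sum_congr rfl fun a _ => by ring
  simp only [boxI_eq E (show 2 ≤ d by omega), Pi.div_apply, boxRatio]
  rw [hsum, ← mul_div_assoc, ← mul_div_assoc, ← sub_div, ← add_div, div_div_div_cancel_right₀ hN]

end Restricted

end LocalToGlobal

theorem corollary4p10 (K : Type*) [Field K] [NumberField K] (d : ℕ) (hd : 3 ≤ d) :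
    -- the union defining the local sets is disjoint and independent of representatives
    (∀ (v : HeightOneSpectrum (𝓞 K)) (b b' : 𝓞 K),
      (b - b' ∈ v.asIdeal → LocalToGlobal.localPiece K d v b = LocalToGlobal.localPiece K d v b') ∧
      (b - b' ∉ v.asIdeal →
        Disjoint (LocalToGlobal.localPiece K d v b) (LocalToGlobal.localPiece K d v b'))) ∧
    -- the system corresponds to the set of shifted Eisenstein polynomials
    (∀ E : LocalToGlobal.IntegralBasis K,
      (LocalToGlobal.shiftedEisensteinSystem K d).CorrespondsTo E
        (LocalToGlobal.shiftedEisenstein K d)) ∧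
    -- the hypotheses of the principle for the `n`-th moment hold for all `n`
    (∀ (E : LocalToGlobal.IntegralBasis K) (n : ℕ), 1 ≤ n →
      (LocalToGlobal.shiftedEisensteinSystem K d).MomentConditions E n) ∧
    -- density, mean, restricted mean and restricted variance
    let s : HeightOneSpectrum (𝓞 K) → ℝ := fun v =>
      ((Ideal.absNorm v.asIdeal : ℝ) - 1) ^ 2 / (Ideal.absNorm v.asIdeal : ℝ) ^ (d + 1)
    let ρ : ℝ := 1 - ∏' v, (1 - s v)
    let μ : ℝ := ∑' v, s v
    let μT : ℝ := ρ⁻¹ * μ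
    Summable s ∧ Summable (fun v => s v ^ 2) ∧ Multipliable (fun v => 1 - s v) ∧ 0 < ρ ∧
    ∀ E : LocalToGlobal.IntegralBasis K,
      LocalToGlobal.HasDensity E (LocalToGlobal.shiftedEisenstein K d) ρ ∧
      (LocalToGlobal.shiftedEisensteinSystem K d).HasMoment E 1 μ ∧
      (LocalToGlobal.shiftedEisensteinSystem K d).HasRestrictedMoment E
        (LocalToGlobal.shiftedEisenstein K d) 1 μT ∧
      (LocalToGlobal.shiftedEisensteinSystem K d).HasRestrictedVariance E
        (LocalToGlobal.shiftedEisenstein K d)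
        (1 / ρ * (μ ^ 2 - ∑' v, s v ^ 2 + μ) - 2 * μT / ρ * μ + μT ^ 2) := by
  have hd2 : 2 ≤ d := by omega
  have hρ : 0 < 1 - ∏' v : HeightOneSpectrum (𝓞 K), (1 - LocalToGlobal.localDensity d v) :=
    sub_pos.2 (LocalToGlobal.tprod_one_sub_localDensity_lt_one K hd)
  -- The local function `s` of the statement is `localDensity d` by definition.
  refine ⟨fun v b b' => ⟨LocalToGlobal.localPiece_eq v hd2,
      LocalToGlobal.disjoint_localPiece v (by omega)⟩,
    fun E => LocalToGlobal.correspondsTo E hd,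
    fun E n hn => LocalToGlobal.momentConditions E hd hn,
    LocalToGlobal.summable_localDensity K hd, LocalToGlobal.summable_localDensity_sq K hd,
    LocalToGlobal.multipliable_one_sub_localDensity K hd, hρ, fun E => ?_⟩
  have h0 := LocalToGlobal.hasDensity_shiftedEisenstein E hd
  have h1 := LocalToGlobal.hasMoment_one E hd
  exact ⟨h0, h1, LocalToGlobal.hasRestrictedMoment_one E hd hρ.ne' h0 h1,
    LocalToGlobal.hasRestrictedVariance E hd hρ.ne' h0 h1 (LocalToGlobal.hasMoment_two E hd)⟩
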